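/- Let $a_1<a_2<a_3<a_4$ (also written $a<b<c<d$) be natural numbers with $\gcd(a_1,a_2,a_3,a_4)=1$ such that every number of the form $a_1^{p}a_2^{q}a_3^{l}a_4^{f}$ with $p,q,l,f\in\mathbb{N}_0$ has only one such representation (this holds, for instance, if the $a_i$ are at least $2$ and pairwise coprime). For real $x$ let $$N_{a,b,c,d}(x)=\#\{(p,q,l,f)\in\mathbb{N}_0^4: a_1^{p}a_2^{q}a_3^{l}a_4^{f}\le x\},$$ let $\chi$ be the characteristic function of $S_{a,b,c,d}=\{a_1^{p}a_2^{q}a_3^{l}a_4^{f}: p,q,l,f\in\mathbb{N}_0\}$, and let $B_1^*(\{t\})=\{t\}-\frac12$ if $t\notin\mathbb{Z}$ and $B_1^*(\{t\})=0$ if $t\in\mathbb{Z}$. Write $L=\log x$, $\ell_i=\log a_i$ and $\Pi=\ell_1\ell_2\ell_3\ell_4$. For $R>0$ and distinct indices put $$P_{ij}(R)=\sum_{k=1}^{\lfloor R\ell_i\rfloor}\frac{\cos\left(2\pi k\frac{L-\frac12\ell_j}{\ell_i}\right)}{k\sin\left(\frac{\pi k\ell_j}{\ell_i}\right)}+\sum_{k=1}^{\lfloor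 R\ell_j\rfloor}\frac{\cos\left(2\pi k\frac{L-\frac12\ell_i}{\ell_j}\right)}{k\sin\left(\frac{\pi k\ell_i}{\ell_j}\right)},$$ $$D_{i;jm}(R)=\sum_{k=1}^{\lfloor R\ell_i\rfloor}\left(\frac{\sin\left(2\pi k\frac{L+\frac12\ell_j-\frac12\ell_m}{\ell_i}\right)}{k\sin\left(\frac{\pi k\ell_j}{\ell_i}\right)\sin\left(\frac{\pi k\ell_m}{\ell_i}\right)}+\frac{\sin\left(2\pi k\frac{L-\frac12\ell_j+\frac12\ell_m}{\ell_i}\right)}{k\sin\left(\frac{\pi k\ell_j}{\ell_i}\right)\sin\left(\frac{\pi k\ell_m}{\ell_i}\right)}\right),$$ $$C_i(R)=\sum_{k=1}^{\lfloor R\ell_i\rfloor}\frac{1}{k}\cos\left(2\pi k\frac{L}{\ell_i}\right)\prod_{j\ne i}\cot\left(\frac{\pi k\ell_j}{\ell_i}\right),$$ and $T_{ijm}(R)=D_{i;jm}(R)+D_{j;im}(R)+D_{m;ij}(R)$, $Q(R)=C_1(R)+C_2(R)+C_3(R)+C_4(R)$. For $\delta>0$ let $G_\delta$ be the set of all real $R$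 with $|R-k/\ell_i|\ge\delta$ for all $k\in\mathbb{N}_0$ and $1\le i\le 4$. For all sufficiently small $\delta>0$ the set $G_\delta$ contains arbitrarily large $R$. For every real $x\ge1$ there are real numbers $P_{ij}$ ($i<j$), $T_{ijm}$ ($i<j<m$) and $Q$ such that, for every $\delta>0$, as $R\to\infty$ with $R\in G_\delta$, $P_{ij}(R)\to P_{ij}$, $T_{ijm}(R)\to T_{ijm}$ and $Q(R)\to Q$, and $$\begin{aligned}N_{a,b,c,d}(x)={}&\frac{L^4}{24\,\Pi}+\sum_{i<j<m}\frac{L^3}{12\,\ell_i\ell_j\ell_m}+\sum_{i}\frac{\ell_i^2L^2}{24\,\Pi}+\sum_{i<j}\frac{L^2}{8\,\ell_i\ell_j}+\sum_i\frac{L}{8\,\ell_i}+\sum_i\sum_{\substack{j<m\\ j,m\ne i}}\frac{\ell_iL}{24\,\ell_j\ell_m}\\&+\frac1{16}+\sum_{i\ne j}\frac{\ell_i}{48\,\ell_j}+\sum_{i<j}\frac{\ell_i^2\ell_j^2}{144\,\Pi}-\sum_i\frac{\ell_i^4}{720\,\Pi}-\frac78\sum_iB_1^*\left(\left\{\frac{L}{\ell_i}\right\}\right)\\&-\frac1{8\pi}\sum_{i<j}P_{ij}-\frac1{16\pi}\sum_{i<j<m}T_{ijm}+\frac1{8\pi}Q+\frac12\chi(x).\end{aligned}$$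 -/

import Mathlib

/-!
With `y = log x` and `ℓᵢ = log aᵢ`, Perron's formula writes the number of quadruples of weight
`∑ eᵢ ℓᵢ ≤ y`, those of weight exactly `y` counted one half, as the integral of
`exp (y s) / (s ∏ (1 - exp (-ℓᵢ s)))` along a vertical line. Over rectangles whose horizontal edges
keep away from the poles `2πim/ℓᵢ` the integral is evaluated by residues: the pole of order five at
`0` contributes the polynomial in `log x`, and the simple poles contribute trigonometric sums. Since
`1 / (1 - exp (-2it)) = (1 - i cot t) / 2`, these sums split over the nonempty subsets `M` of the
bases into cotangent series symmetric in `M`. Perron's formula holds for every subset of the bases,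
so induction on `M` shows that each symmetric series converges, although its summands, one for
each base in `M`, need not.
-/

open Real Set Filter Topology

namespace SmoothCount

/-- The number `a ^ p * b ^ q * c ^ l * d ^ f` attached to the exponents `e = (p, q, l, f)`. -/
def monomial (a b c d : ℕ) (e : ℕ × ℕ × ℕ × ℕ) : ℕ :=
  a ^ e.1 * b ^ e.2.1 * c ^ e.2.2.1 * d ^ e.2.2.2

/-- `N_{a,b,c,d}(x)`: the number of exponent quadruples `(p, q, l, f)` of natural numbers with
`a ^ p * b ^ q * c ^ l * d ^ f ≤ x`. -/
noncomputable def N (a b c d : ℕ) (x : ℝ) : ℕ :=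
  Set.ncard {e : ℕ × ℕ × ℕ × ℕ | (monomial a b c d e : ℝ) ≤ x}

/-- The set `S_{a,b,c,d}` of the numbers `a ^ p * b ^ q * c ^ l * d ^ f`. -/
def S (a b c d : ℕ) : Set ℝ :=
  Set.range fun e : ℕ × ℕ × ℕ × ℕ => (monomial a b c d e : ℝ)

/-- The characteristic function of `S_{a,b,c,d}`. -/
noncomputable def chi (a b c d : ℕ) : ℝ → ℝ :=
  Set.indicator (S a b c d) fun _ => 1

open Classical in
/-- `B₁*({t})`: the value `{t} - 1/2` if `t` is not an integer, and `0` if `t` is an integer. -/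
noncomputable def B1star (t : ℝ) : ℝ :=
  if t ∈ Set.range (fun n : ℤ => (n : ℝ)) then 0 else Int.fract t - 1 / 2

/-- The quartic polynomial in `log x` of the formula. -/
noncomputable def mainPoly (a b c d x : ℝ) : ℝ :=
    log x ^ 4 / (24 * log a * log b * log c * log d) + log x ^ 3 / (12 * log a * log b * log c)
      + log x ^ 3 / (12 * log a * log b * log d) + log x ^ 3 / (12 * log a * log c * log d)
      + log x ^ 3 / (12 * log b * log c * log d)
      + log a * log x ^ 2 / (24 * log b * log c * log d)
      + log b * log x ^ 2 / (24 * log a * log c * log d)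
      + log c * log x ^ 2 / (24 * log a * log b * log d)
      + log d * log x ^ 2 / (24 * log a * log b * log c) + log x ^ 2 / (8 * log a * log b)
      + log x ^ 2 / (8 * log a * log c) + log x ^ 2 / (8 * log a * log d)
      + log x ^ 2 / (8 * log b * log c) + log x ^ 2 / (8 * log b * log d)
      + log x ^ 2 / (8 * log c * log d) + log x / (8 * log a) + log x / (8 * log b)
      + log x / (8 * log c) + log x / (8 * log d) + log a * log x / (24 * log b * log c)
      + log a * log x / (24 * log b * log d) + log a * log x / (24 * log c * log d)
      + log b * log x / (24 * log a * log c) + log b * log x / (24 * log a * log d)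
      + log b * log x / (24 * log c * log d) + log c * log x / (24 * log a * log b)
      + log c * log x / (24 * log a * log d) + log c * log x / (24 * log b * log d)
      + log d * log x / (24 * log a * log b) + log d * log x / (24 * log a * log c)
      + log d * log x / (24 * log b * log c) + 1 / 16 + log a / (48 * log b)
      + log a / (48 * log c) + log a / (48 * log d) + log b / (48 * log a)
      + log b / (48 * log c) + log b / (48 * log d) + log c / (48 * log a)
      + log c / (48 * log b) + log c / (48 * log d) + log d / (48 * log a)
      + log d / (48 * log b) + log d / (48 * log c) + log a * log b / (144 * log c * log d)
      + log a * log c / (144 * log b * log d) + log a * log d / (144 * log b * log c)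
      + log b * log c / (144 * log a * log d) + log b * log d / (144 * log a * log c)
      + log c * log d / (144 * log a * log b) - log a ^ 3 / (720 * log b * log c * log d)
      - log b ^ 3 / (720 * log a * log c * log d) - log c ^ 3 / (720 * log a * log b * log d)
      - log d ^ 3 / (720 * log a * log b * log c)

/-- The pairwise series of the bases `u` and `v`, cut off at `R`. -/
noncomputable def pairSum (u v x R : ℝ) : ℝ :=
  ∑ k ∈ Finset.Icc 1 ⌊R * log u⌋₊,
      cos (2 * π * k * ((log x - 1 / 2 * log v) / log u)) / (k * sin (π * k * log v / log u))
    + ∑ k ∈ Finset.Icc 1 ⌊R * log v⌋₊,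
      cos (2 * π * k * ((log x - 1 / 2 * log u) / log v)) / (k * sin (π * k * log u / log v))

/-- The series to the base `u` with the two sines of `v` and `w` in the denominators, cut off
at `R`. -/
noncomputable def doubleSineSum (u v w x R : ℝ) : ℝ :=
  ∑ k ∈ Finset.Icc 1 ⌊R * log u⌋₊,
    (sin (2 * π * k * ((log x + 1 / 2 * log v - 1 / 2 * log w) / log u))
        / (k * sin (π * k * log v / log u) * sin (π * k * log w / log u))
      + sin (2 * π * k * ((log x - 1 / 2 * log v + 1 / 2 * log w) / log u))
        / (k * sin (π * k * log v / log u) * sin (π * k * log w / log u)))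

/-- The triple-cotangent cosine series to the base `u`, with the cotangents of `v`, `w` and `z`
written as quotients of cosines and sines, cut off at `R`. -/
noncomputable def tripleCotSum (u v w z x R : ℝ) : ℝ :=
  ∑ k ∈ Finset.Icc 1 ⌊R * log u⌋₊,
    cos (π * k * log v / log u) * cos (π * k * log w / log u) * cos (π * k * log z / log u)
        * cos (2 * π * k * (log x / log u))
      / (k * sin (π * k * log v / log u) * sin (π * k * log w / log u)
          * sin (π * k * log z / log u))

/-- The double-sine series to the three bases `u`, `v`, `w` with a common cut-off parameter `R`. -/
noncomputable def doubleSineTriple (u v w x R : ℝ) : ℝ :=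
  doubleSineSum u v w x R + doubleSineSum v u w x R + doubleSineSum w u v x R

/-- The triple-cotangent series to the four bases with a common cut-off parameter `R`. -/
noncomputable def tripleCotQuadruple (u v w z x R : ℝ) : ℝ :=
  tripleCotSum u v w z x R + tripleCotSum v u w z x R + tripleCotSum w u v z x R
    + tripleCotSum z u v w x R

/-- The cut-off parameters `R` that keep a distance at least `δ` from all the points `k / log u`,
where `u` is one of the four bases: these are the values at which some cut-off `⌊R * log u⌋`
jumps. -/
def goodCutoffs (a b c d : ℕ) (δ : ℝ) : Set ℝ :=
  {R | ∀ u ∈ ({a, b, c, d} : Set ℕ), ∀ k : ℕ, δ ≤ |R - k / log u|}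

/-- `R → ∞` through the cut-off parameters that keep the distance `δ` from all jumps. -/
def cutoffFilter (a b c d : ℕ) (δ : ℝ) : Filter ℝ :=
  atTop ⊓ 𝓟 (goodCutoffs a b c d δ)

end SmoothCount

namespace SmoothCount

open Complex (I wedgeIntegral Rectangle)
open scoped Interval ComplexConjugate PowerSeries

section RectangleIntegrals

variable {f g F : ℂ → ℂ} {z w p r : ℂ}

/-- The path from `z` to `w` that first runs horizontally and then vertically: the path of
integration of `Complex.wedgeIntegral z w`. -/
def wedge (z w : ℂ) : Set ℂ :=
  [[z.re, w.re]] ×ℂ {z.im} ∪ {w.re} ×ℂ [[z.im, w.im]]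

lemma horizontal_mem_wedge {x : ℝ} (hx : x ∈ [[z.re, w.re]]) : (x + z.im * I : ℂ) ∈ wedge z w :=
  Or.inl (by simp [Complex.mem_reProdIm, hx])

lemma vertical_mem_wedge {y : ℝ} (hy : y ∈ [[z.im, w.im]]) : (w.re + y * I : ℂ) ∈ wedge z w :=
  Or.inr (by simp [Complex.mem_reProdIm, hy])

lemma wedgeIntegral_congr (h : EqOn f g (wedge z w)) :
    wedgeIntegral z w f = wedgeIntegral z w g :=
  congrArg₂ (· + I • ·)
    (intervalIntegral.integral_congr fun _ hx => h (horizontal_mem_wedge hx))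
    (intervalIntegral.integral_congr fun _ hy => h (vertical_mem_wedge hy))

lemma intervalIntegrable_horizontal (hf : ContinuousOn f (wedge z w)) :
    IntervalIntegrable (fun x : ℝ => f (x + z.im * I)) MeasureTheory.volume z.re w.re :=
  (hf.comp (by fun_prop) fun _ hx => horizontal_mem_wedge hx).intervalIntegrable

lemma intervalIntegrable_vertical (hf : ContinuousOn f (wedge z w)) :
    IntervalIntegrable (fun y : ℝ => f (w.re + y * I)) MeasureTheory.volume z.im w.im :=
  (hf.comp (by fun_prop) fun _ hy => vertical_mem_wedge hy).intervalIntegrable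

lemma wedgeIntegral_sub (hf : ContinuousOn f (wedge z w)) (hg : ContinuousOn g (wedge z w)) :
    wedgeIntegral z w (fun s => f s - g s) = wedgeIntegral z w f - wedgeIntegral z w g := by
  simp only [wedgeIntegral, smul_eq_mul]
  rw [intervalIntegral.integral_sub (intervalIntegrable_horizontal hf)
      (intervalIntegrable_horizontal hg),
    intervalIntegral.integral_sub (intervalIntegrable_vertical hf)
      (intervalIntegrable_vertical hg)]
  ring

lemma wedgeIntegral_const_mul (c : ℂ) (f : ℂ → ℂ) :
    wedgeIntegral z w (fun s => c * f s) = c * wedgeIntegral z w f := by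
  simp only [wedgeIntegral, smul_eq_mul, intervalIntegral.integral_const_mul]
  ring

lemma wedgeIntegral_comp_neg (z w : ℂ) (f : ℂ → ℂ) :
    wedgeIntegral z w (fun s => f (-s)) = -wedgeIntegral (-z) (-w) f := by
  have hor : ∫ x : ℝ in z.re..w.re, f (-(x + z.im * I))
      = -∫ x : ℝ in -z.re..-w.re, f (x + (-z.im : ℝ) * I) := by
    rw [← intervalIntegral.integral_symm,
      ← intervalIntegral.integral_comp_neg fun x : ℝ => f (x + (-z.im : ℝ) * I)]
    exact intervalIntegral.integral_congr fun x _ => congrArg f (by push_cast; ring)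
  have ver : ∫ y : ℝ in z.im..w.im, f (-(w.re + y * I))
      = -∫ y : ℝ in -z.im..-w.im, f ((-w.re : ℝ) + y * I) := by
    rw [← intervalIntegral.integral_symm,
      ← intervalIntegral.integral_comp_neg fun y : ℝ => f ((-w.re : ℝ) + y * I)]
    exact intervalIntegral.integral_congr fun y _ => congrArg f (by push_cast; ring)
  simp only [wedgeIntegral, smul_eq_mul, Complex.neg_re, Complex.neg_im, hor, ver]
  ring

lemma wedgeIntegral_eq_sub_of_hasDerivAt (hf : ContinuousOn f (wedge z w))
    (hF : ∀ s ∈ wedge z w, HasDerivAt F (f s) s) : wedgeIntegral z w f = F w - F z := by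
  have hor : ∫ x : ℝ in z.re..w.re, f (x + z.im * I)
      = F (w.re + z.im * I) - F (z.re + z.im * I) := by
    refine intervalIntegral.integral_eq_sub_of_hasDerivAt (f := fun x : ℝ => F (x + z.im * I))
      (fun x hx => ?_) (intervalIntegrable_horizontal hf)
    simpa [Function.comp_def] using (hF _ (horizontal_mem_wedge hx)).comp x
      ((Complex.ofRealCLM.hasDerivAt (x := x)).add_const _)
  have ver : ∫ y : ℝ in z.im..w.im, I * f (w.re + y * I)
      = F (w.re + w.im * I) - F (w.re + z.im * I) := by
    refine intervalIntegral.integral_eq_sub_of_hasDerivAt (f := fun y : ℝ => F (w.re + y * I))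
      (fun y hy => ?_) ((intervalIntegrable_vertical hf).const_mul I)
    simpa [Function.comp_def, mul_comm] using (hF _ (vertical_mem_wedge hy)).comp y
      (((Complex.ofRealCLM.hasDerivAt (x := y)).mul_const I).const_add _)
  rw [intervalIntegral.integral_const_mul] at ver
  simp only [wedgeIntegral, smul_eq_mul, hor, ver, Complex.re_add_im]
  ring

lemma norm_wedgeIntegral_le {A B : ℝ} (hA : ∀ s ∈ [[z.re, w.re]] ×ℂ {z.im}, ‖f s‖ ≤ A)
    (hB : ∀ s ∈ {w.re} ×ℂ [[z.im, w.im]], ‖f s‖ ≤ B) :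
    ‖wedgeIntegral z w f‖ ≤ A * |w.re - z.re| + B * |w.im - z.im| := by
  refine (norm_add_le _ _).trans (add_le_add ?_ ?_)
  · exact intervalIntegral.norm_integral_le_of_norm_le_const fun x hx =>
      hA _ (by simpa [Complex.mem_reProdIm] using uIoc_subset_uIcc hx)
  · rw [norm_smul, Complex.norm_I, one_mul]
    exact intervalIntegral.norm_integral_le_of_norm_le_const fun y hy =>
      hB _ (by simpa [Complex.mem_reProdIm] using uIoc_subset_uIcc hy)

/-- The integral of `f` along the boundary of the rectangle with the corners `z` and `w`,
counterclockwise if `z` is the lower left corner. -/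
noncomputable def rectIntegral (z w : ℂ) (f : ℂ → ℂ) : ℂ :=
  wedgeIntegral z w f + wedgeIntegral w z f

/-- The boundary of the rectangle with the corners `z` and `w`. -/
def rectBoundary (z w : ℂ) : Set ℂ :=
  wedge z w ∪ wedge w z

lemma rectBoundary_subset_rectangle : rectBoundary z w ⊆ Rectangle z w := by
  rintro s ((⟨h, h'⟩ | ⟨h, h'⟩) | (⟨h, h'⟩ | ⟨h, h'⟩)) <;>
    simp_all [Rectangle, Complex.mem_reProdIm, uIcc_comm]

lemma ne_of_mem_rectBoundary (hp : p ∈ Ioo z.re w.re ×ℂ Ioo z.im w.im) {s : ℂ}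
    (hs : s ∈ rectBoundary z w) : s ≠ p := by
  rintro rfl
  obtain ⟨⟨h₁, h₂⟩, h₃, h₄⟩ := hp
  rcases hs with (⟨-, h⟩ | ⟨h, -⟩) | (⟨-, h⟩ | ⟨h, -⟩) <;>
    simp only [mem_preimage, mem_singleton_iff] at h <;> linarith

lemma rectIntegral_congr (h : EqOn f g (rectBoundary z w)) :
    rectIntegral z w f = rectIntegral z w g :=
  congrArg₂ (· + ·) (wedgeIntegral_congr (h.mono subset_union_left))
    (wedgeIntegral_congr (h.mono subset_union_right))

lemma rectIntegral_sub (hf : ContinuousOn f (rectBoundary z w))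
    (hg : ContinuousOn g (rectBoundary z w)) :
    rectIntegral z w (fun s => f s - g s) = rectIntegral z w f - rectIntegral z w g := by
  simp only [rectIntegral]
  rw [wedgeIntegral_sub (hf.mono subset_union_left) (hg.mono subset_union_left),
    wedgeIntegral_sub (hf.mono subset_union_right) (hg.mono subset_union_right)]
  ring

lemma rectIntegral_const_mul (c : ℂ) (f : ℂ → ℂ) :
    rectIntegral z w (fun s => c * f s) = c * rectIntegral z w f := by
  simp only [rectIntegral, wedgeIntegral_const_mul, mul_add]

lemma rectIntegral_comp_neg (z w : ℂ) (f : ℂ → ℂ) :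
    rectIntegral z w (fun s => f (-s)) = -rectIntegral (-z) (-w) f := by
  simp only [rectIntegral, wedgeIntegral_comp_neg]
  ring

lemma rectIntegral_swap (z w : ℂ) (f : ℂ → ℂ) : rectIntegral z w f = rectIntegral w z f :=
  add_comm _ _

lemma rectIntegral_eq_zero_of_hasDerivAt (hf : ContinuousOn f (rectBoundary z w))
    (hF : ∀ s ∈ rectBoundary z w, HasDerivAt F (f s) s) : rectIntegral z w f = 0 := by
  rw [rectIntegral,
    wedgeIntegral_eq_sub_of_hasDerivAt (hf.mono subset_union_left) fun s hs => hF s (.inl hs),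
    wedgeIntegral_eq_sub_of_hasDerivAt (hf.mono subset_union_right) fun s hs => hF s (.inr hs)]
  ring

lemma rectIntegral_eq_zero_of_differentiableOn (hf : DifferentiableOn ℂ f (Rectangle z w)) :
    rectIntegral z w f = 0 :=
  add_eq_zero_iff_eq_neg.2 (hf.isConservativeOn z w Subset.rfl)

lemma norm_rectIntegral_le {A B : ℝ} (hA : ∀ s ∈ [[z.re, w.re]] ×ℂ {z.im, w.im}, ‖f s‖ ≤ A)
    (hB : ∀ s ∈ {z.re, w.re} ×ℂ [[z.im, w.im]], ‖f s‖ ≤ B) :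
    ‖rectIntegral z w f‖ ≤ 2 * (A * |w.re - z.re| + B * |w.im - z.im|) := by
  have lower := norm_wedgeIntegral_le (z := z) (w := w)
    (fun s hs => hA s ⟨hs.1, .inl hs.2⟩) (fun s hs => hB s ⟨.inr hs.1, hs.2⟩)
  have upper := norm_wedgeIntegral_le (z := w) (w := z)
    (fun s hs => hA s ⟨uIcc_comm z.re w.re ▸ hs.1, .inr hs.2⟩)
    (fun s hs => hB s ⟨.inl hs.1, uIcc_comm z.im w.im ▸ hs.2⟩)
  rw [abs_sub_comm z.re, abs_sub_comm z.im] at upper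
  exact (norm_add_le _ _).trans (by linarith)

end RectangleIntegrals

section Residues

variable {f g : ℂ → ℂ} {z w p r : ℂ}

lemma continuousOn_inv_sub (hp : p ∈ Ioo z.re w.re ×ℂ Ioo z.im w.im) :
    ContinuousOn (fun s => (s - p)⁻¹) (rectBoundary z w) :=
  ContinuousOn.inv₀ (by fun_prop) fun _ hs => sub_ne_zero.2 (ne_of_mem_rectBoundary hp hs)

lemma log_neg_of_im_neg {s : ℂ} (hs : s.im < 0) : Complex.log (-s) = Complex.log s + π * I := by
  rw [Complex.log, Complex.log, Complex.arg_neg_eq_arg_add_pi_of_im_neg hs, norm_neg]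
  push_cast
  ring

-- `log (s - p)` is a primitive along the lower right wedge and `log (p - s)` along the upper left.
lemma rectIntegral_inv_sub (hp : p ∈ Ioo z.re w.re ×ℂ Ioo z.im w.im) :
    rectIntegral z w (fun s => (s - p)⁻¹) = 2 * π * I := by
  have hcont := continuousOn_inv_sub hp
  obtain ⟨⟨hzr, hwr⟩, hzi, hwi⟩ := hp
  have lower : wedgeIntegral z w (fun s => (s - p)⁻¹)
      = Complex.log (w - p) - Complex.log (z - p) := by
    refine wedgeIntegral_eq_sub_of_hasDerivAt (F := fun s => Complex.log (s - p))
      (hcont.mono subset_union_left) fun s hs => ?_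
    have hslit : s - p ∈ Complex.slitPlane := by
      rcases hs with ⟨-, h⟩ | ⟨h, -⟩ <;> simp only [mem_preimage, mem_singleton_iff] at h <;>
        simp only [Complex.mem_slitPlane_iff, Complex.sub_re, Complex.sub_im, h]
      · exact .inr (by linarith)
      · exact .inl (by linarith)
    simpa using ((hasDerivAt_id s).sub_const p).clog hslit
  have upper : wedgeIntegral w z (fun s => (s - p)⁻¹)
      = Complex.log (p - z) - Complex.log (p - w) := by
    refine wedgeIntegral_eq_sub_of_hasDerivAt (F := fun s => Complex.log (p - s))
      (hcont.mono subset_union_right) fun s hs => ?_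
    have hslit : p - s ∈ Complex.slitPlane := by
      rcases hs with ⟨-, h⟩ | ⟨h, -⟩ <;> simp only [mem_preimage, mem_singleton_iff] at h <;>
        simp only [Complex.mem_slitPlane_iff, Complex.sub_re, Complex.sub_im, h]
      · exact .inr (by linarith)
      · exact .inl (by linarith)
    rw [← neg_sub p s, inv_neg]
    simpa [neg_div] using ((hasDerivAt_id s).const_sub p).clog hslit
  have hz := log_neg_of_im_neg (s := z - p) (by simpa using hzi)
  have hw := log_neg_of_im_neg (s := p - w) (by simpa using hwi)
  rw [neg_sub] at hz hw
  rw [rectIntegral, lower, upper, hz, hw]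
  ring

lemma exists_analyticAt_eq_sub_simplePole (hf : ∀ᶠ s in 𝓝[≠] p, DifferentiableAt ℂ f s)
    (hr : Tendsto (fun s => (s - p) * f s) (𝓝[≠] p) (𝓝 r)) :
    ∃ g, AnalyticAt ℂ g p ∧ ∀ s ≠ p, g s = f s - r * (s - p)⁻¹ := by
  set h : ℂ → ℂ := fun s => f s - r * (s - p)⁻¹
  obtain ⟨U, hU, hUf⟩ := (eventually_nhdsWithin_iff.1 hf).exists_mem
  have hd : DifferentiableOn ℂ h (U \ {p}) := fun s hs =>
    ((hUf s hs.1 hs.2).sub (((differentiableAt_id.sub_const p).inv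
      (sub_ne_zero.2 hs.2)).const_mul r)).differentiableWithinAt
  have ho : (fun s => h s - h p) =o[𝓝[≠] p] fun s => (s - p)⁻¹ := by
    refine (Asymptotics.isLittleO_iff_tendsto' (eventually_nhdsWithin_of_forall fun s hs h0 =>
      absurd h0 (inv_ne_zero (sub_ne_zero.2 hs)))).2 ?_
    have hsub : Tendsto (fun s => (s - p) * h p) (𝓝[≠] p) (𝓝 ((p - p) * h p)) :=
      (Continuous.tendsto (by fun_prop) p).mono_left nhdsWithin_le_nhds
    have hlim := (hr.sub_const r).sub hsub
    rw [sub_self, sub_self, zero_mul, sub_zero] at hlim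
    refine hlim.congr' (eventually_nhdsWithin_of_forall fun s hs => ?_)
    have : s - p ≠ 0 := sub_ne_zero.2 hs
    simp only [h]
    field_simp
  exact ⟨_, (Complex.differentiableOn_update_limUnder_of_isLittleO hU hd ho).analyticAt hU,
    fun s hs => Function.update_of_ne hs _ _⟩

lemma differentiableAt_const_mul_inv_sub {s : ℂ} (c : ℂ) (hs : s ≠ p) :
    DifferentiableAt ℂ (fun s => c * (s - p)⁻¹) s :=
  ((differentiableAt_id.sub_const p).inv (sub_ne_zero.2 hs)).const_mul c

lemma tendsto_sub_mul_of_eq_sub_simplePole {q c : ℂ} (hqp : q ≠ p)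
    (hr : Tendsto (fun s => (s - q) * f s) (𝓝[≠] q) (𝓝 r))
    (hg : ∀ s ≠ p, g s = f s - c * (s - p)⁻¹) :
    Tendsto (fun s => (s - q) * g s) (𝓝[≠] q) (𝓝 r) := by
  have hzero : Tendsto (fun s => (s - q) * (c * (s - p)⁻¹)) (𝓝 q) (𝓝 ((q - q) * _)) :=
    (continuous_sub_right q).continuousAt.mul
      (differentiableAt_const_mul_inv_sub c hqp).continuousAt
  have hlim := hr.sub (hzero.mono_left nhdsWithin_le_nhds)
  rw [sub_self, zero_mul, sub_zero] at hlim
  refine hlim.congr' ?_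
  filter_upwards [nhdsWithin_le_nhds (isOpen_ne.mem_nhds hqp)] with s hs
  rw [hg s hs, mul_sub]

lemma rectIntegral_eq_add_of_eq_sub_simplePole (hp : p ∈ Ioo z.re w.re ×ℂ Ioo z.im w.im)
    (hf : ContinuousOn f (rectBoundary z w)) (hg : ∀ s ≠ p, g s = f s - r * (s - p)⁻¹) :
    rectIntegral z w f = 2 * π * I * r + rectIntegral z w g := by
  have hpole : ContinuousOn (fun s => r * (s - p)⁻¹) (rectBoundary z w) :=
    continuousOn_const.mul (continuousOn_inv_sub hp)
  rw [rectIntegral_congr fun s hs => hg s (ne_of_mem_rectBoundary hp hs),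
    rectIntegral_sub hf hpole, rectIntegral_const_mul, rectIntegral_inv_sub hp]
  ring

lemma mem_rectangle_of_mem_interior (hp : p ∈ Ioo z.re w.re ×ℂ Ioo z.im w.im) :
    Rectangle z w ∈ 𝓝 p :=
  mem_of_superset ((isOpen_Ioo.reProdIm isOpen_Ioo).mem_nhds hp) fun _ hs =>
    ⟨Icc_subset_uIcc (Ioo_subset_Icc_self hs.1), Icc_subset_uIcc (Ioo_subset_Icc_self hs.2)⟩

theorem rectIntegral_eq_sum_residues {κ : Type*} (A : Finset κ) (p r : κ → ℂ)
    (hinj : InjOn p A) (hin : ∀ k ∈ A, p k ∈ Ioo z.re w.re ×ℂ Ioo z.im w.im)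
    (hf : ∀ s ∈ Rectangle z w, (∀ k ∈ A, s ≠ p k) → DifferentiableAt ℂ f s)
    (hr : ∀ k ∈ A, Tendsto (fun s => (s - p k) * f s) (𝓝[≠] p k) (𝓝 (r k))) :
    rectIntegral z w f = 2 * π * I * ∑ k ∈ A, r k := by
  classical
  induction A using Finset.induction_on generalizing f with
  | empty =>
    rw [Finset.sum_empty, mul_zero]
    exact rectIntegral_eq_zero_of_differentiableOn fun s hs =>
      (hf s hs (by simp)).differentiableWithinAt
  | insert a A ha ih =>
    simp only [Finset.forall_mem_insert] at hin hf hr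
    have hne : ∀ k ∈ A, p k ≠ p a := fun k hk h => ha <| by
      rwa [← hinj (by simp [hk]) (by simp) h]
    have hf_near : ∀ᶠ s in 𝓝[≠] p a, DifferentiableAt ℂ f s := by
      have hA : ∀ᶠ s in 𝓝 (p a), ∀ k ∈ A, s ≠ p k :=
        (A.eventually_all).2 fun k hk => isOpen_ne.mem_nhds (hne k hk).symm
      filter_upwards [nhdsWithin_le_nhds hA,
        nhdsWithin_le_nhds (mem_rectangle_of_mem_interior hin.1), self_mem_nhdsWithin]
        with s hsA hs hsa using hf s hs ⟨hsa, hsA⟩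
    obtain ⟨g, hga, hg⟩ := exists_analyticAt_eq_sub_simplePole hf_near hr.1
    have hg_diff : ∀ s ∈ Rectangle z w, (∀ k ∈ A, s ≠ p k) → DifferentiableAt ℂ g s := by
      intro s hs hsA
      rcases eq_or_ne s (p a) with rfl | hsa
      · exact hga.differentiableAt
      · have hsub := (hf s hs ⟨hsa, hsA⟩).sub (differentiableAt_const_mul_inv_sub (r a) hsa)
        exact hsub.congr_of_eventuallyEq (eventually_of_mem (isOpen_ne.mem_nhds hsa) hg)
    have hf_cont : ContinuousOn f (rectBoundary z w) := fun s hs =>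
      (hf s (rectBoundary_subset_rectangle hs) ⟨ne_of_mem_rectBoundary hin.1 hs,
        fun k hk => ne_of_mem_rectBoundary (hin.2 k hk) hs⟩).continuousAt.continuousWithinAt
    have hinj_A : InjOn p A := hinj.mono (Finset.coe_subset.2 (Finset.subset_insert a A))
    have hg_integral := ih hinj_A hin.2 hg_diff fun k hk =>
      tendsto_sub_mul_of_eq_sub_simplePole (hne k hk) (hr.2 k hk) hg
    rw [rectIntegral_eq_add_of_eq_sub_simplePole hin.1 hf_cont hg, hg_integral,
      Finset.sum_insert ha, mul_add]

end Residues

section Expansions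

open Asymptotics

variable {f g : ℂ → ℂ} {p q : ℝ⟦X⟧}

/-- `f` has the asymptotic expansion `p` at `0`. The expansion is asserted on a punctured
neighbourhood, so that the value of `f` at `0` plays no role. -/
def HasExpansion (f : ℂ → ℂ) (p : ℝ⟦X⟧) : Prop :=
  ∀ n, (fun s => f s - Polynomial.aeval s (p.trunc n)) =O[𝓝[≠] 0] (· ^ n)

lemma isBigO_aeval_of_X_pow_dvd {n : ℕ} {P : Polynomial ℝ} (h : Polynomial.X ^ n ∣ P) :
    (fun s : ℂ => Polynomial.aeval s P) =O[𝓝[≠] 0] (· ^ n) := by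
  obtain ⟨Q, rfl⟩ := h
  have hQ : (fun s : ℂ => Polynomial.aeval s Q) =O[𝓝[≠] 0] fun _ => (1 : ℂ) :=
    (((Polynomial.continuous_aeval Q).tendsto 0).mono_left nhdsWithin_le_nhds).isBigO_one ℂ
  simpa using (isBigO_refl (fun s : ℂ => s ^ n) (𝓝[≠] 0)).mul hQ

lemma isBigO_aeval_one (P : Polynomial ℝ) :
    (fun s : ℂ => Polynomial.aeval s P) =O[𝓝[≠] 0] fun _ => (1 : ℂ) := by
  simpa using isBigO_aeval_of_X_pow_dvd (n := 0) (P := P) (by simp)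

lemma X_pow_dvd_trunc_mul_trunc_sub (n : ℕ) (p q : ℝ⟦X⟧) :
    Polynomial.X ^ n ∣ p.trunc n * q.trunc n - (p * q).trunc n := by
  refine Polynomial.X_pow_dvd_iff.2 fun d hd => ?_
  rw [Polynomial.coeff_sub, PowerSeries.coeff_trunc, if_pos hd,
    PowerSeries.coeff_mul_eq_coeff_trunc_mul_trunc p q hd, ← Polynomial.coe_mul,
    Polynomial.coeff_coe, sub_self]

namespace HasExpansion

lemma congr (hf : HasExpansion f p) (h : f =ᶠ[𝓝[≠] 0] g) : HasExpansion g p := fun n =>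
  (hf n).congr' (h.mono fun s hs => by simp only [hs]) .rfl

lemma isBigO_one (hf : HasExpansion f p) : f =O[𝓝[≠] 0] fun _ => (1 : ℂ) := by
  simpa using hf 0

lemma one : HasExpansion (fun _ => 1) 1
  | 0 => by simpa using isBigO_refl (fun _ : ℂ => (1 : ℂ)) (𝓝[≠] 0)
  | n + 1 => by simpa [PowerSeries.trunc_one] using isBigO_zero (fun s : ℂ => s ^ (n + 1)) _

lemma sub (hf : HasExpansion f p) (hg : HasExpansion g q) :
    HasExpansion (fun s => f s - g s) (p - q) := fun n =>
  ((hf n).sub (hg n)).congr_left fun s => by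
    rw [PowerSeries.trunc_sub, map_sub]
    ring

lemma mul (hf : HasExpansion f p) (hg : HasExpansion g q) :
    HasExpansion (fun s => f s * g s) (p * q) := fun n => by
  have left := (hf n).mul hg.isBigO_one
  have right := (isBigO_aeval_one (p.trunc n)).mul (hg n)
  have rest := isBigO_aeval_of_X_pow_dvd (X_pow_dvd_trunc_mul_trunc_sub n p q)
  simp only [mul_one, one_mul] at left right
  refine ((left.add right).add rest).congr_left fun s => ?_
  simp only [map_sub, map_mul]
  ring

lemma prod {ι : Type*} {K : Finset ι} {f : ι → ℂ → ℂ} {p : ι → ℝ⟦X⟧}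
    (h : ∀ i ∈ K, HasExpansion (f i) (p i)) :
    HasExpansion (fun s => ∏ i ∈ K, f i s) (∏ i ∈ K, p i) := by
  classical
  induction K using Finset.induction_on with
  | empty => simpa using one
  | insert a K ha ih =>
    rw [Finset.forall_mem_insert] at h
    simpa only [Finset.prod_insert ha] using h.1.mul (ih h.2)

lemma tendsto_sub_div_pow (hf : HasExpansion f p) (n : ℕ) :
    Tendsto (fun s => (f s - Polynomial.aeval s (p.trunc n)) / s ^ n) (𝓝[≠] 0)
      (𝓝 (p.coeff n : ℝ)) := by
  have hid : Tendsto (fun s : ℂ => s) (𝓝[≠] 0) (𝓝 0) := nhdsWithin_le_nhds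
  have hrest : (fun s => (f s - Polynomial.aeval s (p.trunc n)) / s ^ n - (p.coeff n : ℝ))
      =O[𝓝[≠] 0] fun s : ℂ => s := by
    refine ((isBigO_refl (fun s : ℂ => (s ^ n)⁻¹) _).mul (hf (n + 1))).congr' ?_ ?_ <;>
      refine eventually_nhdsWithin_of_forall fun s (hs : s ≠ 0) => ?_
    · simp only [PowerSeries.trunc_succ, map_add, Polynomial.aeval_monomial,
        Complex.coe_algebraMap]
      field_simp
      ring
    · simp only [pow_succ]
      field_simp
  simpa using (hrest.trans_tendsto hid).add_const ((p.coeff n : ℝ) : ℂ)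

lemma inv (hf : HasExpansion f p) (hpq : p * q = 1) : HasExpansion (fun s => (f s)⁻¹) q := by
  have hlim : Tendsto f (𝓝[≠] 0) (𝓝 (p.coeff 0 : ℝ)) := by
    simpa using hf.tendsto_sub_div_pow 0
  have hp0 : ((p.coeff 0 : ℝ) : ℂ) ≠ 0 := by
    have h := congrArg PowerSeries.constantCoeff hpq
    rw [map_mul, map_one] at h
    simpa using left_ne_zero_of_mul_eq_one h
  have hinv : (fun s => (f s)⁻¹) =O[𝓝[≠] 0] fun _ => (1 : ℂ) := (hlim.inv₀ hp0).isBigO_one ℂ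
  intro n
  have hQ := (hf n).mul (isBigO_aeval_one (q.trunc n))
  have hrest := isBigO_aeval_of_X_pow_dvd (X_pow_dvd_trunc_mul_trunc_sub n p q)
  have hone := one n
  rw [hpq] at hrest
  simp only [mul_one] at hQ
  refine (hinv.mul ((hone.sub hrest).sub hQ)).congr' ?_ (.of_eq (by simp))
  filter_upwards [hlim.eventually_ne hp0] with s hs
  simp only [map_sub, map_mul]
  field_simp
  ring

lemma of_mul_X (h : HasExpansion (fun s => s * f s) (PowerSeries.X * p)) : HasExpansion f p := by
  intro n
  have htrunc : (PowerSeries.X * p).trunc (n + 1) = Polynomial.X * p.trunc n := by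
    ext (_ | d) <;> simp [PowerSeries.coeff_trunc, PowerSeries.coeff_succ_X_mul]
  refine ((isBigO_refl (fun s : ℂ => s⁻¹) _).mul (h (n + 1))).congr' ?_ ?_ <;>
    refine eventually_nhdsWithin_of_forall fun s (hs : s ≠ 0) => ?_
  · simp only [htrunc, map_mul, Polynomial.aeval_X]
    field_simp
  · simp only [pow_succ']
    field_simp

lemma aeval_trunc_rescale (p : ℝ⟦X⟧) (y : ℝ) (n : ℕ) (s : ℂ) :
    Polynomial.aeval s ((PowerSeries.rescale y p).trunc n)
      = Polynomial.aeval (s * y) (p.trunc n) := by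
  simp only [Polynomial.aeval_def, PowerSeries.eval₂_trunc_eq_sum_range,
    PowerSeries.coeff_rescale, map_mul, map_pow, mul_pow, Complex.coe_algebraMap]
  exact Finset.sum_congr rfl fun _ _ => by ring

lemma isBigO_comp_mul_const {l : Filter ℂ} {n : ℕ} {y : ℝ}
    (h : (fun s => f s - Polynomial.aeval s (p.trunc n)) =O[l] (· ^ n)) {l' : Filter ℂ}
    (hy : Tendsto (fun s : ℂ => s * y) l' l) :
    (fun s => f (s * y) - Polynomial.aeval s ((PowerSeries.rescale y p).trunc n))
      =O[l'] (· ^ n) := by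
  simp only [aeval_trunc_rescale]
  refine (h.comp_tendsto hy).trans ?_
  simpa only [Function.comp_def, mul_pow, mul_comm] using
    (isBigO_refl (fun s : ℂ => s ^ n) l').const_mul_left ((y : ℂ) ^ n)

lemma comp_mul_const (hf : HasExpansion f p) {y : ℝ} (hy : y ≠ 0) :
    HasExpansion (fun s => f (s * y)) (PowerSeries.rescale y p) := fun n =>
  isBigO_comp_mul_const (hf n) <| tendsto_nhdsWithin_iff.2
    ⟨((continuous_mul_const (y : ℂ)).tendsto' _ _ (zero_mul _)).mono_left nhdsWithin_le_nhds,
      eventually_nhdsWithin_of_forall fun _ hs => mul_ne_zero hs (by exact_mod_cast hy)⟩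

lemma exp_mul (y : ℝ) : HasExpansion (fun s => Complex.exp (s * y))
    (PowerSeries.rescale y (PowerSeries.exp ℝ)) := fun n => by
  have h : (fun s => Complex.exp s - Polynomial.aeval s ((PowerSeries.exp ℝ).trunc n))
      =O[𝓝 0] (· ^ n) := by
    refine (Complex.exp_sub_sum_range_isBigO_pow n).congr_left fun s => ?_
    simp [Polynomial.aeval_def, PowerSeries.eval₂_trunc_eq_sum_range, div_eq_inv_mul]
  exact (isBigO_comp_mul_const h ((continuous_mul_const (y : ℂ)).tendsto' _ _ (zero_mul _))).mono
    nhdsWithin_le_nhds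

end HasExpansion

lemma bernoulli'PowerSeries_mul_one_sub_exp_neg :
    bernoulli'PowerSeries ℝ * (1 - PowerSeries.evalNegHom (PowerSeries.exp ℝ)) = PowerSeries.X :=
  calc _ = bernoulli'PowerSeries ℝ * (PowerSeries.exp ℝ - 1)
          * PowerSeries.evalNegHom (PowerSeries.exp ℝ) := by
        linear_combination -bernoulli'PowerSeries ℝ * PowerSeries.exp_mul_exp_neg_eq_one (A := ℝ)
    _ = PowerSeries.X := by
        rw [bernoulli'PowerSeries_mul_exp_sub_one, mul_assoc,
          PowerSeries.exp_mul_exp_neg_eq_one, mul_one]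

lemma hasExpansion_div_one_sub_exp_neg :
    HasExpansion (fun s => s / (1 - Complex.exp (-s))) (bernoulli'PowerSeries ℝ) := by
  obtain ⟨u, hu⟩ : PowerSeries.X ∣ 1 - PowerSeries.evalNegHom (PowerSeries.exp ℝ) := by
    rw [PowerSeries.X_dvd_iff, ← PowerSeries.coeff_zero_eq_constantCoeff_apply, map_sub,
      PowerSeries.evalNegHom, PowerSeries.coeff_rescale]
    simp
  have hBu : u * bernoulli'PowerSeries ℝ = 1 := by
    refine mul_left_cancel₀ PowerSeries.X_ne_zero ?_
    rw [← mul_assoc, ← hu, mul_comm, bernoulli'PowerSeries_mul_one_sub_exp_neg, mul_one]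
  have hnum : HasExpansion (fun s => 1 - Complex.exp (-s)) (PowerSeries.X * u) := by
    simpa [← hu, PowerSeries.evalNegHom] using HasExpansion.one.sub (.exp_mul (-1))
  have hquot : HasExpansion (fun s => (1 - Complex.exp (-s)) / s) u :=
    .of_mul_X (hnum.congr (eventually_nhdsWithin_of_forall fun s (hs : s ≠ 0) =>
      (mul_div_cancel₀ _ hs).symm))
  simpa only [inv_div] using hquot.inv hBu

end Expansions

section NormBounds

lemma norm_one_sub_exp_neg_sq (z : ℂ) :
    ‖1 - Complex.exp (-z)‖ ^ 2 = (1 - exp (-z.re)) ^ 2 + 2 * exp (-z.re) * (1 - cos z.im) := by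
  rw [Complex.sq_norm, Complex.normSq_apply]
  simp only [Complex.sub_re, Complex.one_re, Complex.exp_re, Complex.neg_re, Complex.neg_im,
    Real.cos_neg, Complex.sub_im, Complex.one_im, Complex.exp_im, Real.sin_neg]
  linear_combination exp (-z.re) ^ 2 * sin_sq_add_cos_sq z.im

lemma max_one_exp_neg_le_of_le_one_sub_cos {z : ℂ} {κ : ℝ} (hκ : 0 < κ) (h : κ ≤ 1 - cos z.im) :
    max 1 (exp (-z.re)) ≤ 2 / κ * ‖1 - Complex.exp (-z)‖ := by
  have hκ2 : κ / 2 ≤ 1 := by linarith [neg_one_le_cos z.im]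
  have hnorm_sq := norm_one_sub_exp_neg_sq z
  set w := exp (-z.re)
  have hw : 0 < w := exp_pos _
  have hmax : (max 1 w) ^ 2 ≤ 1 + w ^ 2 := by
    rcases max_choice 1 w with h | h <;> rw [h] <;> nlinarith
  have hsq : (κ / 2 * max 1 w) ^ 2 ≤ ‖1 - Complex.exp (-z)‖ ^ 2 := calc
    (κ / 2 * max 1 w) ^ 2 ≤ κ / 2 * (1 + w ^ 2) := by
      rw [mul_pow]
      exact mul_le_mul (by nlinarith) hmax (by positivity) (by positivity)
    _ ≤ (1 - w) ^ 2 + 2 * w * κ := by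
      nlinarith [mul_nonneg (sub_nonneg.2 hκ2) (sq_nonneg (1 - w)), mul_pos hw hκ]
    _ ≤ ‖1 - Complex.exp (-z)‖ ^ 2 := by
      rw [hnorm_sq]
      gcongr
  have := abs_le_of_sq_le_sq hsq (norm_nonneg _)
  rw [div_mul_eq_mul_div, le_div_iff₀ hκ]
  linarith [le_abs_self (κ / 2 * max 1 w)]

lemma max_one_exp_neg_le_of_log_two_le {z : ℂ} (h : log 2 ≤ |z.re|) :
    max 1 (exp (-z.re)) ≤ 2 * ‖1 - Complex.exp (-z)‖ := by
  have hle := norm_sub_norm_le (1 : ℂ) (Complex.exp (-z))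
  have hge := norm_sub_norm_le (Complex.exp (-z)) (1 : ℂ)
  rw [norm_sub_rev] at hge
  rw [Complex.norm_exp, Complex.neg_re, norm_one] at hle hge
  rcases le_abs.1 h with h | h
  · have : exp (-z.re) ≤ 1 / 2 := by
      rw [exp_neg, ← one_div]
      exact one_div_le_one_div_of_le two_pos ((log_le_iff_le_exp two_pos).1 h)
    exact max_le (by linarith) (by linarith)
  · have := (log_le_iff_le_exp two_pos).1 h
    exact max_le (by linarith) (by linarith)

lemma eight_mul_sq_le_one_sub_cos {t ε : ℝ} (hε : 0 ≤ ε) (h : ∀ k : ℤ, ε ≤ |t - k|) :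
    8 * ε ^ 2 ≤ 1 - cos (2 * π * t) := by
  set r := t - round t with hr
  have hcos : cos (2 * π * t) = cos (2 * π * r) := by
    rw [← cos_sub_int_mul_two_pi (2 * π * t) (round t), hr]
    congr 1
    ring
  have hupper : cos (2 * π * r) ≤ 1 - 2 / π ^ 2 * (2 * π * r) ^ 2 := by
    refine cos_le_one_sub_mul_cos_sq ?_
    rw [abs_mul, abs_of_pos two_pi_pos]
    nlinarith [pi_pos, abs_sub_round t]
  have hε2 : ε ^ 2 ≤ r ^ 2 := by
    rw [← sq_abs r]
    exact pow_le_pow_left₀ hε (h _) 2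
  have hquad : 2 / π ^ 2 * (2 * π * r) ^ 2 = 8 * r ^ 2 := by
    field_simp
    ring
  linarith

end NormBounds

section Contours

variable {ι : Type*} {ℓ : ι → ℝ} {C R : ℝ}

/-- The upper right corner `√R + 2πRi` of the rectangles of integration, which are symmetric about
the origin. Their horizontal sides separate poles of Perron's kernel, the width `√R` is small
enough not to spoil the decay `1 / R` there. -/
noncomputable def corner (R : ℝ) : ℂ :=
  ⟨√R, 2 * π * R⟩

/-- The boundary of the rectangle with the corners `±(√R + 2πRi)`. -/
noncomputable def contour (R : ℝ) : Set ℂ :=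
  rectBoundary (-corner R) (corner R)

lemma zero_mem_interior (hR : 0 < R) :
    0 ∈ Ioo (-corner R).re (corner R).re ×ℂ Ioo (-corner R).im (corner R).im := by
  have := Real.sqrt_pos.2 hR
  have : 0 < 2 * π * R := by positivity
  exact ⟨by simpa [corner], by simpa [corner]⟩

lemma abs_re_of_mem {s : ℂ} (h : s.re ∈ ({(-corner R).re, (corner R).re} : Set ℝ)) :
    |s.re| = √R := by
  rcases h with h | h <;> rw [h] <;> simp [corner]

lemma abs_im_of_mem (hR : 0 < R) {s : ℂ} (h : s.im ∈ ({(-corner R).im, (corner R).im} : Set ℝ)) :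
    |s.im| = 2 * π * R := by
  rcases h with h | h <;> rw [h] <;> simp [corner, abs_of_pos pi_pos, hR.le]

lemma abs_re_or_abs_im_of_mem_contour (hR : 0 < R) {s : ℂ} (hs : s ∈ contour R) :
    |s.re| = √R ∨ |s.im| = 2 * π * R := by
  rcases hs with (⟨-, h⟩ | ⟨h, -⟩) | (⟨-, h⟩ | ⟨h, -⟩)
  · exact .inr (abs_im_of_mem hR (.inl h))
  · exact .inl (abs_re_of_mem (.inr h))
  · exact .inr (abs_im_of_mem hR (.inr h))
  · exact .inl (abs_re_of_mem (.inl h))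

lemma horizontal_mem_contour {s : ℂ}
    (hs : s ∈ [[(-corner R).re, (corner R).re]] ×ℂ {(-corner R).im, (corner R).im}) :
    s ∈ contour R := by
  rcases hs with ⟨hre, him | him⟩
  · exact .inl (.inl ⟨hre, him⟩)
  · exact .inr (.inl ⟨uIcc_comm _ (corner R).re ▸ hre, him⟩)

lemma vertical_mem_contour {s : ℂ}
    (hs : s ∈ {(-corner R).re, (corner R).re} ×ℂ [[(-corner R).im, (corner R).im]]) :
    s ∈ contour R := by
  rcases hs with ⟨hre | hre, him⟩
  · exact .inr (.inr ⟨hre, uIcc_comm _ (corner R).im ▸ him⟩)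
  · exact .inl (.inr ⟨hre, him⟩)

/-- A filter at infinity along which `R * ℓ i` stays away from the integers, so that the
horizontal sides of the contours stay away from the poles of Perron's kernel. -/
structure IsAdmissible (ℓ : ι → ℝ) (l : Filter ℝ) : Prop where
  le_atTop : l ≤ atTop
  avoids : ∀ i, ∃ ε > 0, ∀ᶠ R in l, ∀ k : ℤ, ε ≤ |R * ℓ i - k|

/-- The factors `1 - exp (-s * ℓ i)` are bounded below on the contour, with the constant `C`, both
absolutely and relative to the size of the exponential. -/
structure ContourBound (ℓ : ι → ℝ) (C R : ℝ) : Prop where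
  pos : 0 < R
  nonneg : 0 ≤ C
  max_le : ∀ s ∈ contour R, ∀ i, max 1 (exp (-(s.re * ℓ i))) ≤ C * ‖1 - Complex.exp (-(s * ℓ i))‖

lemma IsAdmissible.exists_max_le {l : Filter ℝ} (hl : IsAdmissible ℓ l) {i : ι} (hpos : 0 < ℓ i) :
    ∃ C ≥ 0, ∀ᶠ R in l, ∀ s ∈ contour R,
      max 1 (exp (-(s.re * ℓ i))) ≤ C * ‖1 - Complex.exp (-(s * ℓ i))‖ := by
  obtain ⟨ε, hε, havoid⟩ := hl.avoids i
  have hwide : ∀ᶠ R in l, log 2 ≤ √R * ℓ i :=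
    hl.le_atTop ((tendsto_sqrt_atTop.atTop_mul_const hpos).eventually_ge_atTop _)
  refine ⟨max 2 (2 / (8 * ε ^ 2)), by positivity, ?_⟩
  filter_upwards [havoid, hwide, hl.le_atTop (eventually_gt_atTop 0)] with R havoid hwide hR s hs
  have hre : (s * ℓ i).re = s.re * ℓ i := by simp
  have him : (s * ℓ i).im = s.im * ℓ i := by simp
  rw [← hre]
  rcases abs_re_or_abs_im_of_mem_contour hR hs with h | h
  · have hlog : log 2 ≤ |(s * ℓ i).re| := by rwa [hre, abs_mul, h, abs_of_pos hpos]
    exact (max_one_exp_neg_le_of_log_two_le hlog).trans (by gcongr; exact le_max_left _ _)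
  · have hcos : cos (s * ℓ i).im = cos (2 * π * (R * ℓ i)) := by
      rw [him, ← cos_abs, abs_mul, h, abs_of_pos hpos, mul_assoc]
    have hdist : 8 * ε ^ 2 ≤ 1 - cos (s * ℓ i).im :=
      hcos ▸ eight_mul_sq_le_one_sub_cos hε.le havoid
    exact (max_one_exp_neg_le_of_le_one_sub_cos (by positivity) hdist).trans
      (by gcongr; exact le_max_right _ _)

lemma IsAdmissible.exists_contourBound [Finite ι] {l : Filter ℝ} (hl : IsAdmissible ℓ l)
    (hpos : ∀ i, 0 < ℓ i) : ∃ C, ∀ᶠ R in l, ContourBound ℓ C R := by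
  have := Fintype.ofFinite ι
  choose C hC hbound using fun i => hl.exists_max_le (hpos i)
  refine ⟨∑ i, C i, ?_⟩
  filter_upwards [eventually_all.2 hbound, hl.le_atTop (eventually_gt_atTop 0)] with R hbound hR
  refine ⟨hR, Finset.sum_nonneg fun i _ => hC i, fun s hs i => (hbound i s hs).trans ?_⟩
  gcongr
  exact Finset.single_le_sum (fun j _ => hC j) (Finset.mem_univ i)

lemma ContourBound.ne_zero (h : ContourBound ℓ C R) {s : ℂ} (hs : s ∈ contour R) : s ≠ 0 :=
  ne_of_mem_rectBoundary (zero_mem_interior h.pos) hs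

lemma ContourBound.one_sub_exp_ne_zero (h : ContourBound ℓ C R) {s : ℂ} (hs : s ∈ contour R)
    (i : ι) : 1 - Complex.exp (-(s * ℓ i)) ≠ 0 := fun h0 => by
  have := h.max_le s hs i
  rw [h0, norm_zero, mul_zero] at this
  linarith [le_max_left 1 (exp (-(s.re * ℓ i)))]

end Contours

section PerronKernel

variable {ι : Type*} {ℓ : ι → ℝ} {K : Finset ι} {C R y : ℝ}

/-- The product of the geometric series `∑ n, exp (-s * n * ℓ i)` over `i ∈ K`: the generating
Dirichlet series of the semigroup spanned by the `exp (ℓ i)`. -/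
noncomputable def geomProd (ℓ : ι → ℝ) (K : Finset ι) (s : ℂ) : ℂ :=
  ∏ i ∈ K, (1 - Complex.exp (-(s * ℓ i)))⁻¹

/-- The integrand of Perron's formula for the sum of the coefficients of `geomProd ℓ K`. -/
noncomputable def perronKernel (ℓ : ι → ℝ) (K : Finset ι) (y : ℝ) (s : ℂ) : ℂ :=
  Complex.exp (s * y) / s * geomProd ℓ K s

/-- The normalized integral of Perron's kernel along the contour of height `2πR`. -/
noncomputable def perronIntegral (ℓ : ι → ℝ) (K : Finset ι) (y R : ℝ) : ℂ :=
  (2 * π * I)⁻¹ * rectIntegral (-corner R) (corner R) (perronKernel ℓ K y)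

lemma differentiableAt_perronKernel {s : ℂ} (hs : s ≠ 0)
    (h : ∀ i ∈ K, 1 - Complex.exp (-(s * ℓ i)) ≠ 0) :
    DifferentiableAt ℂ (perronKernel ℓ K y) s := by
  have hprod : DifferentiableAt ℂ (geomProd ℓ K) s :=
    DifferentiableAt.fun_finsetProd fun i hi => by fun_prop (disch := exact h i hi)
  have hexp : DifferentiableAt ℂ (fun s : ℂ => Complex.exp (s * y) / s) s := by
    fun_prop (disch := assumption)
  exact hexp.mul hprod

lemma ContourBound.continuousOn_perronKernel (h : ContourBound ℓ C R) :
    ContinuousOn (perronKernel ℓ K y) (contour R) := fun _ hs =>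
  (differentiableAt_perronKernel (h.ne_zero hs)
    fun i _ => h.one_sub_exp_ne_zero hs i).continuousAt.continuousWithinAt

lemma ContourBound.norm_geomProd_le (h : ContourBound ℓ C R) {s : ℂ} (hs : s ∈ contour R) :
    ‖geomProd ℓ K s‖ ≤ C ^ K.card := by
  rw [geomProd, norm_prod, ← Finset.prod_const]
  refine Finset.prod_le_prod (fun _ _ => norm_nonneg _) fun i _ => ?_
  rw [norm_inv, inv_le_iff_one_le_mul₀ (norm_pos_iff.2 (h.one_sub_exp_ne_zero hs i))]
  exact (le_max_left _ _).trans (h.max_le s hs i)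

lemma ContourBound.norm_geomProd_le_mul_exp (h : ContourBound ℓ C R) {s : ℂ}
    (hs : s ∈ contour R) :
    ‖geomProd ℓ K s‖ ≤ C ^ K.card * exp (s.re * ∑ i ∈ K, ℓ i) := by
  rw [geomProd, norm_prod, ← Finset.prod_const, Finset.mul_sum, exp_sum, ← Finset.prod_mul_distrib]
  refine Finset.prod_le_prod (fun _ _ => norm_nonneg _) fun i _ => ?_
  rw [norm_inv, inv_le_iff_one_le_mul₀ (norm_pos_iff.2 (h.one_sub_exp_ne_zero hs i))]
  have := (le_max_right _ _).trans (h.max_le s hs i)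
  rw [exp_neg, inv_le_iff_one_le_mul₀ (exp_pos _)] at this
  linarith

lemma ContourBound.norm_perronKernel_le (h : ContourBound ℓ C R) {ε : ℝ} (hy : ε ≤ -y)
    (hy' : ε ≤ y + ∑ i ∈ K, ℓ i) {s : ℂ} (hs : s ∈ contour R) :
    ‖perronKernel ℓ K y s‖ ≤ C ^ K.card * exp (-(ε * |s.re|)) / ‖s‖ := by
  have hC := h.nonneg
  have hnorm : ‖perronKernel ℓ K y s‖ = exp (s.re * y) * ‖geomProd ℓ K s‖ / ‖s‖ := by
    rw [perronKernel, norm_mul, norm_div, Complex.norm_exp, Complex.re_mul_ofReal]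
    ring
  rw [hnorm]
  refine div_le_div_of_nonneg_right ?_ (norm_nonneg _)
  rcases le_total 0 s.re with h0 | h0
  · calc exp (s.re * y) * ‖geomProd ℓ K s‖ ≤ exp (-(ε * |s.re|)) * C ^ K.card := by
          rw [abs_of_nonneg h0]
          exact mul_le_mul (exp_le_exp.2 (by nlinarith)) (h.norm_geomProd_le hs)
            (norm_nonneg _) (exp_pos _).le
      _ = C ^ K.card * exp (-(ε * |s.re|)) := mul_comm _ _
  · calc exp (s.re * y) * ‖geomProd ℓ K s‖
        ≤ exp (s.re * y) * (C ^ K.card * exp (s.re * ∑ i ∈ K, ℓ i)) := by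
          gcongr
          exact h.norm_geomProd_le_mul_exp hs
      _ = C ^ K.card * exp (s.re * (y + ∑ i ∈ K, ℓ i)) := by
          rw [mul_add, exp_add]
          ring
      _ ≤ C ^ K.card * exp (-(ε * |s.re|)) := by
          rw [abs_of_nonpos h0]
          gcongr
          nlinarith

lemma ContourBound.norm_rectIntegral_perronKernel_le (h : ContourBound ℓ C R) {ε : ℝ} (hε : 0 ≤ ε)
    (hy : ε ≤ -y) (hy' : ε ≤ y + ∑ i ∈ K, ℓ i) :
    ‖rectIntegral (-corner R) (corner R) (perronKernel ℓ K y)‖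
      ≤ C ^ K.card * (2 / π * (√R)⁻¹ + 8 * π * (√R * exp (-ε * √R))) := by
  have hC := h.nonneg
  have hR := h.pos
  have hroot := Real.sqrt_pos.2 hR
  have hheight : 0 < 2 * π * R := by positivity
  refine (norm_rectIntegral_le (A := C ^ K.card / (2 * π * R))
    (B := C ^ K.card * exp (-(ε * √R)) / √R) (fun s hs => ?_) (fun s hs => ?_)).trans_eq ?_
  · have him : |s.im| = 2 * π * R := abs_im_of_mem hR hs.2
    refine (h.norm_perronKernel_le hy hy' (horizontal_mem_contour hs)).trans ?_
    refine div_le_div₀ (by positivity) ?_ hheight (him ▸ Complex.abs_im_le_norm s)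
    refine mul_le_of_le_one_right (by positivity) (exp_le_one_iff.2 ?_)
    exact neg_nonpos.2 (by positivity)
  · have hre : |s.re| = √R := abs_re_of_mem hs.1
    refine (h.norm_perronKernel_le hy hy' (vertical_mem_contour hs)).trans ?_
    rw [hre]
    exact div_le_div_of_nonneg_left (by positivity) hroot (hre ▸ Complex.abs_re_le_norm s)
  · have hsq : R = √R * √R := (Real.mul_self_sqrt hR.le).symm
    simp only [corner, Complex.neg_re, Complex.neg_im, sub_neg_eq_add, neg_mul]
    rw [abs_of_pos (by positivity), abs_of_pos (by positivity)]
    generalize √R = r at *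
    subst hsq
    field_simp
    ring

lemma IsAdmissible.tendsto_perronIntegral_zero [Finite ι] {l : Filter ℝ} (hl : IsAdmissible ℓ l)
    (hpos : ∀ i, 0 < ℓ i) (hy : y < 0) (hy' : -∑ i ∈ K, ℓ i < y) :
    Tendsto (perronIntegral ℓ K y) l (𝓝 0) := by
  obtain ⟨C, hC⟩ := hl.exists_contourBound hpos
  set ε := min (-y) (y + ∑ i ∈ K, ℓ i)
  have hε : 0 < ε := lt_min (by linarith) (by linarith)
  have hlim : Tendsto (fun R : ℝ => C ^ K.card
      * (2 / π * (√R)⁻¹ + 8 * π * (√R * exp (-ε * √R)))) l (𝓝 0) := by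
    have hdecay := (tendsto_rpow_mul_exp_neg_mul_atTop_nhds_zero 1 ε hε).const_mul (8 * π)
    have hinv := tendsto_inv_atTop_zero.const_mul (2 / π)
    simpa using (((hinv.add hdecay).comp tendsto_sqrt_atTop).const_mul (C ^ K.card)).mono_left
      hl.le_atTop
  have hrect := squeeze_zero_norm' (hC.mono fun R hR =>
    hR.norm_rectIntegral_perronKernel_le hε.le (min_le_left _ _) (min_le_right _ _)) hlim
  rw [← mul_zero (2 * π * I : ℂ)⁻¹]
  exact hrect.const_mul _

end PerronKernel

section WeightedCount

variable {ι : Type*} {ℓ : ι → ℝ} {K : Finset ι} {a : ι} {y : ℝ}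

/-- The exponent vectors supported on `K` whose `ℓ`-weight lies in `s`. -/
def exponents (ℓ : ι → ℝ) (K : Finset ι) (s : Set ℝ) : Set (ι → ℕ) :=
  {e | (∀ i ∉ K, e i = 0) ∧ ∑ i ∈ K, e i * ℓ i ∈ s}

/-- The number of exponent vectors supported on `K` of `ℓ`-weight at most `y`, where those of
weight exactly `y` count one half: the value to which Perron's integral converges. -/
noncomputable def weightedCount (ℓ : ι → ℝ) (K : Finset ι) (y : ℝ) : ℝ :=
  ((exponents ℓ K (Iic y)).ncard + (exponents ℓ K (Iio y)).ncard) / 2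

lemma exponents_mono {s t : Set ℝ} (h : s ⊆ t) : exponents ℓ K s ⊆ exponents ℓ K t :=
  fun _ he => ⟨he.1, h he.2⟩

lemma finite_exponents [Finite ι] (hpos : ∀ i, 0 < ℓ i) {s : Set ℝ} (hs : BddAbove s) :
    (exponents ℓ K s).Finite := by
  obtain ⟨y, hy⟩ := hs
  refine (Set.Finite.pi' fun i => Set.finite_Iic ⌊y / ℓ i⌋₊).subset fun e he i => ?_
  by_cases hi : i ∈ K
  · refine Nat.le_floor ((le_div_iff₀ (hpos i)).2 (le_trans ?_ (hy he.2)))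
    exact Finset.single_le_sum (f := fun i => e i * ℓ i)
      (fun j _ => mul_nonneg (Nat.cast_nonneg _) (hpos j).le) hi
  · simp [he.1 i hi]

lemma exponents_empty (ℓ : ι → ℝ) (s : Set ℝ) :
    exponents ℓ ∅ s = {e | e = 0 ∧ 0 ∈ s} := by
  ext e
  simp [exponents, funext_iff]

lemma add_single_mem_exponents_iff [DecidableEq ι] (ha : a ∈ K) {e : ι → ℕ} {s : Set ℝ} :
    e + Pi.single a 1 ∈ exponents ℓ K s ↔ e ∈ exponents ℓ K ((· + ℓ a) ⁻¹' s) := by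
  have hsupp : ∀ i ∉ K, (e + (Pi.single a 1 : ι → ℕ)) i = e i := fun i hi => by
    simp [(ne_of_mem_of_not_mem ha hi).symm]
  have hsum : ∑ i ∈ K, ((e + (Pi.single a 1 : ι → ℕ)) i : ℕ) * ℓ i = ∑ i ∈ K, e i * ℓ i + ℓ a := by
    simp [add_mul, Finset.sum_add_distrib, Pi.single_apply, ha]
  exact and_congr (forall₂_congr fun i hi => by rw [hsupp i hi]) (by rw [hsum]; rfl)

lemma mem_exponents_insert_of_eq_zero [DecidableEq ι] (ha : a ∉ K) {e : ι → ℕ} (he : e a = 0)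
    {s : Set ℝ} : e ∈ exponents ℓ (insert a K) s ↔ e ∈ exponents ℓ K s :=
  and_congr (by grind) (by simp [Finset.sum_insert ha, he])

lemma exponents_insert [DecidableEq ι] (ha : a ∉ K) (s : Set ℝ) :
    exponents ℓ (insert a K) s =
      exponents ℓ K s ∪ (· + Pi.single a 1) '' exponents ℓ (insert a K) ((· + ℓ a) ⁻¹' s) := by
  have hmem := Finset.mem_insert_self a K
  ext e
  constructor
  · intro he
    rcases Nat.eq_zero_or_pos (e a) with h0 | h0
    · exact .inl ((mem_exponents_insert_of_eq_zero ha h0).1 he)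
    · obtain ⟨e, rfl⟩ : ∃ e', e = e' + Pi.single a 1 :=
        ⟨e - Pi.single a 1, (tsub_add_cancel_of_le fun i => by by_cases hi : i = a <;> grind).symm⟩
      exact .inr ⟨e, (add_single_mem_exponents_iff hmem).1 he, rfl⟩
  · rintro (he | ⟨e, he, rfl⟩)
    · exact (mem_exponents_insert_of_eq_zero ha (he.1 a ha)).2 he
    · exact (add_single_mem_exponents_iff hmem).2 he

lemma disjoint_exponents [DecidableEq ι] (ha : a ∉ K) (s : Set ℝ) (t : Set (ι → ℕ)) :
    Disjoint (exponents ℓ K s) ((· + Pi.single a 1) '' t) := by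
  rw [Set.disjoint_left]
  rintro _ he ⟨e, -, rfl⟩
  simpa using he.1 a ha

lemma ncard_exponents_insert [Finite ι] [DecidableEq ι] (hpos : ∀ i, 0 < ℓ i) (ha : a ∉ K)
    {s : Set ℝ} (hs : BddAbove s) :
    (exponents ℓ (insert a K) s).ncard =
      (exponents ℓ K s).ncard + (exponents ℓ (insert a K) ((· + ℓ a) ⁻¹' s)).ncard := by
  have hfin := finite_exponents (K := insert a K) hpos hs
  rw [exponents_insert ha] at hfin
  rw [exponents_insert ha, ncard_union_eq (disjoint_exponents ha s _)
    (hfin.subset subset_union_left) (hfin.subset subset_union_right),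
    ncard_image_of_injective _ (add_left_injective _)]

lemma weightedCount_insert [Finite ι] [DecidableEq ι] (hpos : ∀ i, 0 < ℓ i) (ha : a ∉ K) (y : ℝ) :
    weightedCount ℓ (insert a K) y =
      weightedCount ℓ (insert a K) (y - ℓ a) + weightedCount ℓ K y := by
  rw [weightedCount, ncard_exponents_insert hpos ha bddAbove_Iic,
    ncard_exponents_insert hpos ha bddAbove_Iio, preimage_add_const_Iic, preimage_add_const_Iio,
    weightedCount, weightedCount]
  push_cast
  ring

lemma weightedCount_of_neg (hpos : ∀ i, 0 < ℓ i) (hy : y < 0) : weightedCount ℓ K y = 0 := by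
  have hempty : exponents ℓ K (Iic y) = ∅ := by
    refine eq_empty_of_forall_notMem fun e he => ?_
    have : 0 ≤ ∑ i ∈ K, e i * ℓ i :=
      Finset.sum_nonneg fun i _ => mul_nonneg (Nat.cast_nonneg _) (hpos i).le
    exact (this.trans he.2).not_gt hy
  have hempty' : exponents ℓ K (Iio y) = ∅ :=
    subset_empty_iff.1 (hempty ▸ exponents_mono Iio_subset_Iic_self)
  simp [weightedCount, hempty, hempty']

lemma weightedCount_empty_of_pos (ℓ : ι → ℝ) (hy : 0 < y) : weightedCount ℓ ∅ y = 1 := by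
  simp [weightedCount, exponents_empty, hy, hy.le]

lemma weightedCount_empty_zero (ℓ : ι → ℝ) : weightedCount ℓ ∅ 0 = 1 / 2 := by
  simp [weightedCount, exponents_empty]

end WeightedCount

section PerronFormula

variable {ι : Type*} {ℓ : ι → ℝ} {K : Finset ι} {C R y : ℝ} {a : ι}

lemma perronIntegral_empty (ℓ : ι → ℝ) (y : ℝ) (hR : 0 < R) : perronIntegral ℓ ∅ y R = 1 := by
  have hresidue : Tendsto (fun s => (s - 0) * perronKernel ℓ ∅ y s) (𝓝[≠] 0) (𝓝 1) := by
    have hexp : Tendsto (fun s : ℂ => Complex.exp (s * y)) (𝓝[≠] 0) (𝓝 1) := by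
      have : Continuous fun s : ℂ => Complex.exp (s * y) := by fun_prop
      simpa using (this.tendsto 0).mono_left nhdsWithin_le_nhds
    refine hexp.congr' ?_
    filter_upwards [self_mem_nhdsWithin] with s (hs : s ≠ 0)
    simp only [perronKernel, geomProd, Finset.prod_empty]
    field_simp
    ring
  have hintegral := rectIntegral_eq_sum_residues {()} (fun _ => 0) (fun _ => 1) (by simp)
    (fun _ _ => zero_mem_interior hR)
    (fun s _ hs => differentiableAt_perronKernel (hs () (by simp)) (by simp))
    (fun _ _ => hresidue)
  rw [perronIntegral, hintegral, Finset.sum_const, Finset.card_singleton, one_smul, mul_one,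
    inv_mul_cancel₀ Complex.two_pi_I_ne_zero]

lemma perronKernel_insert [DecidableEq ι] (ha : a ∉ K) {s : ℂ}
    (hs : 1 - Complex.exp (-(s * ℓ a)) ≠ 0) :
    perronKernel ℓ K y s =
      perronKernel ℓ (insert a K) y s - perronKernel ℓ (insert a K) (y - ℓ a) s := by
  have hexp : Complex.exp (s * (y - ℓ a : ℝ))
      = Complex.exp (s * y) * Complex.exp (-(s * ℓ a)) := by
    rw [← Complex.exp_add]
    push_cast
    ring_nf
  simp only [perronKernel, hexp, geomProd, Finset.prod_insert ha]
  field_simp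

lemma ContourBound.perronIntegral_insert [DecidableEq ι] (h : ContourBound ℓ C R) (ha : a ∉ K)
    (y : ℝ) : perronIntegral ℓ (insert a K) y R =
      perronIntegral ℓ (insert a K) (y - ℓ a) R + perronIntegral ℓ K y R := by
  have hsub : rectIntegral (-corner R) (corner R) (perronKernel ℓ K y) = _ :=
    (rectIntegral_congr fun s hs => perronKernel_insert ha (h.one_sub_exp_ne_zero hs a)).trans
      (rectIntegral_sub h.continuousOn_perronKernel h.continuousOn_perronKernel)
  simp only [perronIntegral, hsub]
  ring

lemma perronKernel_singleton_zero_neg (ℓ : ι → ℝ) (a : ι) {s : ℂ}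
    (ha : 1 - Complex.exp (-(s * ℓ a)) ≠ 0) :
    perronKernel ℓ {a} 0 (-s) = perronKernel ℓ {a} 0 s - (s - 0)⁻¹ := by
  have hexp := Complex.exp_ne_zero (s * ℓ a)
  rw [Complex.exp_neg] at ha
  have ha' : Complex.exp (s * ℓ a) - 1 ≠ 0 := fun h => ha (by rw [sub_eq_zero.1 h]; simp)
  have hneg : 1 - Complex.exp (s * ℓ a) ≠ 0 := fun h => ha' (by rw [← neg_sub, h, neg_zero])
  simp only [perronKernel, geomProd, Finset.prod_singleton, Complex.ofReal_zero, mul_zero, neg_mul,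
    neg_neg, sub_zero, Complex.exp_neg, Complex.exp_zero]
  rcases eq_or_ne s 0 with rfl | hs
  · simp
  rw [← sub_eq_zero]
  field_simp
  ring

/-- Up to the pole at the origin, the kernel is an odd function if the jump sits at `y = 0`. -/
lemma ContourBound.perronIntegral_singleton_zero (h : ContourBound ℓ C R) (a : ι) :
    perronIntegral ℓ {a} 0 R = 1 / 2 := by
  have hneg := rectIntegral_comp_neg (-corner R) (corner R) (perronKernel ℓ {a} 0)
  rw [neg_neg, rectIntegral_swap (corner R), rectIntegral_congr fun s hs =>
      perronKernel_singleton_zero_neg ℓ a (h.one_sub_exp_ne_zero hs a),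
    rectIntegral_sub h.continuousOn_perronKernel (continuousOn_inv_sub (zero_mem_interior h.pos)),
    rectIntegral_inv_sub (zero_mem_interior h.pos)] at hneg
  have hhalf : rectIntegral (-corner R) (corner R) (perronKernel ℓ {a} 0)
      = 2 * π * I * (1 / 2) := by
    linear_combination hneg / 2
  rw [perronIntegral, hhalf, inv_mul_cancel_left₀ Complex.two_pi_I_ne_zero]

variable [Finite ι] {l : Filter ℝ}

lemma IsAdmissible.tendsto_perronIntegral_of_neg (hl : IsAdmissible ℓ l) (hpos : ∀ i, 0 < ℓ i)
    (hy : -∑ i ∈ K, ℓ i < y) (hneg : y < 0) :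
    Tendsto (perronIntegral ℓ K y) l (𝓝 (weightedCount ℓ K y : ℂ)) := by
  rw [weightedCount_of_neg hpos hneg, Complex.ofReal_zero]
  exact hl.tendsto_perronIntegral_zero hpos hneg hy

lemma IsAdmissible.tendsto_perronIntegral_insert [DecidableEq ι] (hl : IsAdmissible ℓ l)
    (hpos : ∀ i, 0 < ℓ i) (ha : a ∉ K)
    (hK : Tendsto (perronIntegral ℓ K y) l (𝓝 (weightedCount ℓ K y : ℂ)))
    (hprev : Tendsto (perronIntegral ℓ (insert a K) (y - ℓ a)) l
      (𝓝 (weightedCount ℓ (insert a K) (y - ℓ a) : ℂ))) :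
    Tendsto (perronIntegral ℓ (insert a K) y) l (𝓝 (weightedCount ℓ (insert a K) y : ℂ)) := by
  obtain ⟨C, hC⟩ := hl.exists_contourBound hpos
  rw [weightedCount_insert hpos ha, Complex.ofReal_add]
  exact (hprev.add hK).congr' (hC.mono fun R hR => (hR.perronIntegral_insert ha y).symm)

lemma IsAdmissible.tendsto_perronIntegral_insert_of_zero [DecidableEq ι]
    (hl : IsAdmissible ℓ l) (hpos : ∀ i, 0 < ℓ i) (ha : a ∉ K)
    (hzero : Tendsto (perronIntegral ℓ (insert a K) 0) l (𝓝 (weightedCount ℓ (insert a K) 0 : ℂ)))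
    (hK : ∀ y > 0, Tendsto (perronIntegral ℓ K y) l (𝓝 (weightedCount ℓ K y : ℂ)))
    (hy : -∑ i ∈ insert a K, ℓ i < y) :
    Tendsto (perronIntegral ℓ (insert a K) y) l (𝓝 (weightedCount ℓ (insert a K) y : ℂ)) := by
  have hsum : ℓ a ≤ ∑ i ∈ insert a K, ℓ i :=
    Finset.single_le_sum (fun i _ => (hpos i).le) (Finset.mem_insert_self a K)
  obtain ⟨m, hm⟩ := exists_nat_gt (y / ℓ a)
  rw [div_lt_iff₀ (hpos a)] at hm
  induction m generalizing y with
  | zero => exact hl.tendsto_perronIntegral_of_neg hpos hy (by simpa using hm)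
  | succ m ih =>
    rcases lt_trichotomy y 0 with hneg | rfl | hgt
    · exact hl.tendsto_perronIntegral_of_neg hpos hy hneg
    · exact hzero
    · refine hl.tendsto_perronIntegral_insert hpos ha (hK y hgt) (ih (by linarith) ?_)
      push_cast at hm
      linarith

theorem IsAdmissible.tendsto_perronIntegral (hl : IsAdmissible ℓ l) (hpos : ∀ i, 0 < ℓ i)
    (hK : K.Nonempty) (hy : -∑ i ∈ K, ℓ i < y) :
    Tendsto (perronIntegral ℓ K y) l (𝓝 (weightedCount ℓ K y : ℂ)) := by
  classical
  obtain ⟨C, hC⟩ := hl.exists_contourBound hpos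
  induction hK using Finset.Nonempty.cons_induction generalizing y with
  | singleton a =>
    have ha : a ∉ (∅ : Finset ι) := Finset.notMem_empty a
    rw [← insert_empty_eq] at hy ⊢
    refine hl.tendsto_perronIntegral_insert_of_zero hpos ha ?_ (fun y hy => ?_) hy
    · have hhalf : weightedCount ℓ {a} 0 = 1 / 2 := by
        rw [← insert_empty_eq, weightedCount_insert hpos ha,
          weightedCount_of_neg hpos (by simpa using hpos a), weightedCount_empty_zero, zero_add]
      rw [insert_empty_eq, hhalf]
      refine tendsto_const_nhds.congr' (hC.mono fun R hR => ?_)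
      rw [hR.perronIntegral_singleton_zero]
      push_cast
      rfl
    · rw [weightedCount_empty_of_pos ℓ hy]
      refine tendsto_const_nhds.congr' (hC.mono fun R hR => ?_)
      rw [perronIntegral_empty ℓ y hR.pos, Complex.ofReal_one]
  | cons a K ha hK ih =>
    rw [Finset.cons_eq_insert] at hy ⊢
    have hsum : 0 < ∑ i ∈ K, ℓ i := Finset.sum_pos (fun i _ => hpos i) hK
    have hneg : -∑ i ∈ insert a K, ℓ i < 0 - ℓ a := by
      rw [Finset.sum_insert ha]
      linarith
    refine hl.tendsto_perronIntegral_insert_of_zero hpos ha ?_ (fun y hy => ih (by linarith)) hy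
    exact hl.tendsto_perronIntegral_insert hpos ha (ih (by linarith))
      (hl.tendsto_perronIntegral_of_neg hpos hneg (by linarith [hpos a]))

end PerronFormula

section Poles

variable {ι : Type*} {ℓ : ι → ℝ} {K : Finset ι} {i j : ι} {m n : ℤ} {C R y : ℝ}

/-- The `m`-th zero of `1 - exp (-s * ℓ i)`, a pole of Perron's kernel. -/
noncomputable def pole (ℓ : ι → ℝ) (i : ι) (m : ℤ) : ℂ := 2 * π * I * m / ℓ i

lemma pole_eq (ℓ : ι → ℝ) (i : ι) (m : ℤ) : pole ℓ i m = (2 * π * (m / ℓ i) : ℝ) * I := by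
  rw [pole]
  push_cast
  ring

lemma pole_re (ℓ : ι → ℝ) (i : ι) (m : ℤ) : (pole ℓ i m).re = 0 := by
  rw [pole_eq, Complex.re_ofReal_mul, Complex.I_re, mul_zero]

lemma pole_im (ℓ : ι → ℝ) (i : ι) (m : ℤ) : (pole ℓ i m).im = 2 * π * (m / ℓ i) := by
  rw [pole_eq, Complex.im_ofReal_mul, Complex.I_im, mul_one]

lemma pole_eq_pole_iff : pole ℓ i m = pole ℓ j n ↔ m / ℓ i = n / ℓ j := by
  rw [Complex.ext_iff, pole_re, pole_re, pole_im, pole_im, eq_self, true_and]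
  exact mul_right_inj' (by positivity)

lemma pole_zero (ℓ : ι → ℝ) (i : ι) : pole ℓ i 0 = 0 := by simp [pole]

lemma pole_injective (hi : 0 < ℓ i) : Function.Injective (pole ℓ i) := fun m n h => by
  rw [pole_eq_pole_iff, div_left_inj' hi.ne'] at h
  exact_mod_cast h

lemma pole_ne_zero (hi : 0 < ℓ i) (hm : m ≠ 0) : pole ℓ i m ≠ 0 := fun h =>
  hm (pole_injective hi (h.trans (pole_zero ℓ i).symm))

lemma pole_ne_pole (hpos : ∀ i, 0 < ℓ i) (hirr : Irrational (ℓ i / ℓ j)) (hm : m ≠ 0) :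
    pole ℓ i m ≠ pole ℓ j n := fun h => by
  have hi := (hpos i).ne'
  have hj := (hpos j).ne'
  have hm' : (m : ℝ) ≠ 0 := Int.cast_ne_zero.2 hm
  rw [pole_eq_pole_iff, div_eq_div_iff hi hj] at h
  have hn : (n : ℝ) ≠ 0 := fun h0 => mul_ne_zero hm' hj (by rw [h, h0, zero_mul])
  refine hirr ⟨m / n, ?_⟩
  push_cast
  rw [div_eq_div_iff hn hj, h, mul_comm]

lemma exp_neg_pole_mul (hi : 0 < ℓ i) (m : ℤ) : Complex.exp (-(pole ℓ i m * ℓ i)) = 1 := by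
  refine Complex.exp_eq_one_iff.2 ⟨-m, ?_⟩
  rw [pole, div_mul_cancel₀ _ (Complex.ofReal_ne_zero.2 hi.ne')]
  push_cast
  ring

lemma exists_eq_pole (hi : 0 < ℓ i) {s : ℂ} (hs : 1 - Complex.exp (-(s * ℓ i)) = 0) :
    ∃ m, s = pole ℓ i m := by
  obtain ⟨m, hm⟩ := Complex.exp_eq_one_iff.1 (sub_eq_zero.1 hs).symm
  refine ⟨-m, ?_⟩
  rw [pole, eq_div_iff (Complex.ofReal_ne_zero.2 hi.ne')]
  push_cast
  linear_combination -hm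

lemma one_sub_exp_neg_pole_mul_ne_zero (hpos : ∀ i, 0 < ℓ i) (hirr : Irrational (ℓ i / ℓ j))
    (hm : m ≠ 0) : 1 - Complex.exp (-(pole ℓ i m * ℓ j)) ≠ 0 := fun h =>
  have ⟨_, hn⟩ := exists_eq_pole (hpos j) h
  pole_ne_pole hpos hirr hm hn

lemma ContourBound.abs_mul_ne (h : ContourBound ℓ C R) (hi : 0 < ℓ i) (m : ℤ) :
    |(m : ℝ)| ≠ R * ℓ i := fun hm => by
  have him : |(pole ℓ i m).im| = 2 * π * R := by
    rw [pole_im, abs_mul, abs_div, hm, abs_of_pos hi, mul_div_cancel_right₀ _ hi.ne',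
      abs_of_pos two_pi_pos]
  have hmem : pole ℓ i m ∈ contour R := by
    refine horizontal_mem_contour ⟨?_, ?_⟩
    · have := sqrt_nonneg R
      simp [pole_re, corner, uIcc_of_le, this]
    · rcases abs_choice (pole ℓ i m).im with h' | h'
      · exact .inr (h'.symm.trans him)
      · exact .inl (neg_eq_iff_eq_neg.1 (h'.symm.trans him))
  exact h.one_sub_exp_ne_zero hmem i (by rw [exp_neg_pole_mul hi, sub_self])

lemma abs_le_floor_iff (hR : 0 < R) (hi : 0 < ℓ i) :
    |m| ≤ ⌊R * ℓ i⌋₊ ↔ |(m : ℝ)| ≤ R * ℓ i := by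
  rw [Int.abs_eq_natAbs, Nat.cast_le, Nat.le_floor_iff (mul_pos hR hi).le, Nat.cast_natAbs,
    Int.cast_abs]

lemma ContourBound.pole_mem_interior (h : ContourBound ℓ C R) (hi : 0 < ℓ i)
    (hm : |m| ≤ ⌊R * ℓ i⌋₊) : pole ℓ i m ∈
      Ioo (-corner R).re (corner R).re ×ℂ Ioo (-corner R).im (corner R).im := by
  have hlt : |(m : ℝ)| < R * ℓ i := ((abs_le_floor_iff h.pos hi).1 hm).lt_of_ne (h.abs_mul_ne hi m)
  have him : |(pole ℓ i m).im| < 2 * π * R := by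
    rw [pole_im, abs_mul, abs_of_pos two_pi_pos, abs_div, abs_of_pos hi]
    gcongr
    rwa [div_lt_iff₀ hi]
  refine ⟨?_, abs_lt.1 him⟩
  simp [pole_re, corner, h.pos]

lemma abs_le_floor_of_pole_mem_rectangle (hR : 0 < R) (hi : 0 < ℓ i)
    (hm : pole ℓ i m ∈ Rectangle (-corner R) (corner R)) : |m| ≤ ⌊R * ℓ i⌋₊ := by
  have him : |(pole ℓ i m).im| ≤ 2 * π * R := by
    have h := hm.2
    have him_nonneg : 0 ≤ (corner R).im := mul_nonneg two_pi_pos.le hR.le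
    rw [mem_preimage, Complex.neg_im, uIcc_of_le (neg_le_self him_nonneg)] at h
    exact abs_le.2 h
  rw [pole_im, abs_mul, abs_of_pos two_pi_pos, mul_le_mul_iff_right₀ two_pi_pos, abs_div,
    abs_of_pos hi, div_le_iff₀ hi] at him
  exact (abs_le_floor_iff hR hi).2 him

end Poles

section PerronResidues

variable {ι : Type*} {ℓ : ι → ℝ} {K : Finset ι} {i : ι} {m : ℤ} {C R y : ℝ}

lemma tendsto_sub_pole_mul_inv_one_sub_exp (hi : 0 < ℓ i) (m : ℤ) :
    Tendsto (fun s => (s - pole ℓ i m) * (1 - Complex.exp (-(s * ℓ i)))⁻¹) (𝓝[≠] pole ℓ i m)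
      (𝓝 (ℓ i : ℂ)⁻¹) := by
  have hexp := exp_neg_pole_mul hi m
  have hderiv : HasDerivAt (fun s : ℂ => 1 - Complex.exp (-(s * ℓ i))) (ℓ i) (pole ℓ i m) := by
    simpa [hexp] using (((hasDerivAt_id (pole ℓ i m)).mul_const (ℓ i : ℂ)).neg.cexp).const_sub 1
  refine ((hasDerivAt_iff_tendsto_slope.1 hderiv).inv₀
    (Complex.ofReal_ne_zero.2 hi.ne')).congr fun s => ?_
  rw [slope_def_field, hexp, sub_self, sub_zero, inv_div, div_eq_mul_inv]

/-- The principal part at the origin of a function `f` such that `s ^ (n + 1) * f s` has the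
expansion `p`, without its residue term. -/
noncomputable def polarPart (p : ℝ⟦X⟧) (n : ℕ) (s : ℂ) : ℂ :=
  ∑ j ∈ Finset.range n, (p.coeff j : ℝ) * s ^ ((j : ℤ) - n - 1)

lemma differentiableAt_polarPart (p : ℝ⟦X⟧) (n : ℕ) {s : ℂ} (hs : s ≠ 0) :
    DifferentiableAt ℂ (polarPart p n) s :=
  DifferentiableAt.fun_sum fun _ _ => (differentiableAt_zpow.2 (.inl hs)).const_mul _

lemma rectIntegral_polarPart (p : ℝ⟦X⟧) (n : ℕ) {z w : ℂ}
    (h0 : 0 ∈ Ioo z.re w.re ×ℂ Ioo z.im w.im) : rectIntegral z w (polarPart p n) = 0 := by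
  have hne : ∀ s ∈ rectBoundary z w, s ≠ 0 := fun s => ne_of_mem_rectBoundary h0
  refine rectIntegral_eq_zero_of_hasDerivAt
    (F := fun s => ∑ j ∈ Finset.range n,
      (p.coeff j : ℝ) / ((j : ℤ) - n : ℤ) * s ^ ((j : ℤ) - n))
    (fun s hs => (differentiableAt_polarPart p n (hne s hs)).continuousAt.continuousWithinAt)
    fun s hs => HasDerivAt.fun_sum fun j hj => ?_
  have hj : (((j : ℤ) - n : ℤ) : ℂ) ≠ 0 :=
    Int.cast_ne_zero.2 (by have := Finset.mem_range.1 hj; omega)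
  have hderiv := (hasDerivAt_zpow ((j : ℤ) - n) s (.inl (hne s hs))).const_mul
    ((p.coeff j : ℝ) / ((j : ℤ) - n : ℤ) : ℂ)
  rwa [← mul_assoc, div_mul_cancel₀ _ hj] at hderiv

lemma HasExpansion.tendsto_mul_sub_polarPart {f : ℂ → ℂ} {p : ℝ⟦X⟧} {n : ℕ}
    (hf : HasExpansion (fun s => s ^ (n + 1) * f s) p) :
    Tendsto (fun s => s * (f s - polarPart p n s)) (𝓝[≠] 0) (𝓝 (p.coeff n : ℝ)) := by
  refine (hf.tendsto_sub_div_pow n).congr' ?_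
  filter_upwards [self_mem_nhdsWithin] with s (hs : s ≠ 0)
  have hpolar : s ^ (n + 1) * polarPart p n s = Polynomial.aeval s (p.trunc n) := by
    rw [polarPart, Polynomial.aeval_def, PowerSeries.eval₂_trunc_eq_sum_range, Finset.mul_sum]
    refine Finset.sum_congr rfl fun j _ => ?_
    rw [zpow_sub₀ hs, zpow_sub₀ hs, zpow_natCast, zpow_natCast, zpow_one, pow_succ,
      Complex.coe_algebraMap]
    field_simp
  rw [← hpolar, ← mul_sub]
  field_simp
  ring

/-- The expansion at the origin of `exp (s * y) * ∏ i ∈ K, s * ℓ i / (1 - exp (-s * ℓ i))`. -/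
noncomputable def toddSeries (ℓ : ι → ℝ) (K : Finset ι) (y : ℝ) : ℝ⟦X⟧ :=
  PowerSeries.rescale y (PowerSeries.exp ℝ)
    * ∏ i ∈ K, PowerSeries.rescale (ℓ i) (bernoulli'PowerSeries ℝ)

lemma hasExpansion_perronKernel (hℓ : ∀ i ∈ K, ℓ i ≠ 0) (y : ℝ) :
    HasExpansion (fun s => s ^ (K.card + 1) * ((∏ i ∈ K, (ℓ i : ℂ)) * perronKernel ℓ K y s))
      (toddSeries ℓ K y) := by
  have htodd := (HasExpansion.exp_mul y).mul (HasExpansion.prod fun i hi =>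
    hasExpansion_div_one_sub_exp_neg.comp_mul_const (hℓ i hi))
  refine htodd.congr ?_
  filter_upwards [self_mem_nhdsWithin] with s (hs : s ≠ 0)
  simp only [perronKernel, geomProd, div_eq_mul_inv, Finset.prod_mul_distrib, Finset.prod_const,
    pow_succ]
  field_simp

/-- The residue of Perron's kernel at the origin: the polynomial main term of the count. -/
noncomputable def mainTerm (ℓ : ι → ℝ) (K : Finset ι) (y : ℝ) : ℝ :=
  (toddSeries ℓ K y).coeff K.card / ∏ i ∈ K, ℓ i

lemma sum_Icc_neg_erase_zero {M : Type*} [AddCommMonoid M] (f : ℤ → M) (n : ℕ) :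
    ∑ m ∈ (Finset.Icc (-n : ℤ) n).erase 0, f m = ∑ k ∈ Finset.Icc 1 n, (f k + f (-k)) := by
  have hsplit : (Finset.Icc (-n : ℤ) n).erase 0
      = (Finset.Icc 1 n).image (fun k : ℕ => (k : ℤ)) ∪
        (Finset.Icc 1 n).image (fun k : ℕ => (-k : ℤ)) := by
    ext m
    simp only [Finset.mem_erase, Finset.mem_Icc, Finset.mem_union, Finset.mem_image]
    constructor
    · rintro ⟨h0, h1, h2⟩
      rcases h0.lt_or_gt with h | h
      · exact .inr ⟨m.natAbs, by omega, by omega⟩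
      · exact .inl ⟨m.natAbs, by omega, by omega⟩
    · rintro (⟨k, hk, rfl⟩ | ⟨k, hk, rfl⟩) <;> omega
  have hdisj : Disjoint ((Finset.Icc 1 n).image (fun k : ℕ => (k : ℤ)))
      ((Finset.Icc 1 n).image (fun k : ℕ => (-k : ℤ))) := by
    simp only [Finset.disjoint_left, Finset.mem_image, Finset.mem_Icc]
    rintro _ ⟨k, hk, rfl⟩ ⟨k', hk', h⟩
    omega
  rw [hsplit, Finset.sum_union hdisj, Finset.sum_image (by simp), Finset.sum_image (by simp),
    Finset.sum_add_distrib]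

/-- Perron's kernel with its principal part at the origin reduced to the residue term. -/
noncomputable def reducedKernel (ℓ : ι → ℝ) (K : Finset ι) (y : ℝ) (s : ℂ) : ℂ :=
  perronKernel ℓ K y s - (∏ i ∈ K, (ℓ i : ℂ))⁻¹ * polarPart (toddSeries ℓ K y) K.card s

lemma tendsto_mul_reducedKernel (hℓ : ∀ i ∈ K, ℓ i ≠ 0) (y : ℝ) :
    Tendsto (fun s => s * reducedKernel ℓ K y s) (𝓝[≠] 0) (𝓝 (mainTerm ℓ K y : ℂ)) := by
  have hprod : (∏ i ∈ K, (ℓ i : ℂ)) ≠ 0 :=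
    Finset.prod_ne_zero_iff.2 fun i hi => Complex.ofReal_ne_zero.2 (hℓ i hi)
  have hlim := (hasExpansion_perronKernel hℓ y).tendsto_mul_sub_polarPart.div_const
    (∏ i ∈ K, (ℓ i : ℂ))
  rw [mainTerm, Complex.ofReal_div, Complex.ofReal_prod]
  refine hlim.congr fun s => ?_
  simp only [reducedKernel]
  field_simp

/-- The poles of Perron's kernel inside the contour: `none` stands for the origin, and `⟨i, m⟩`
for `pole ℓ i m`. -/
noncomputable def enclosedPoles (ℓ : ι → ℝ) (K : Finset ι) (R : ℝ) :
    Finset (Option (Σ _ : ι, ℤ)) :=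
  Finset.insertNone (K.sigma fun i => (Finset.Icc (-⌊R * ℓ i⌋₊ : ℤ) ⌊R * ℓ i⌋₊).erase 0)

lemma some_mem_enclosedPoles :
    some ⟨i, m⟩ ∈ enclosedPoles ℓ K R ↔ i ∈ K ∧ m ≠ 0 ∧ |m| ≤ ⌊R * ℓ i⌋₊ := by
  simp [enclosedPoles, abs_le]

/-- The position in `ℂ` of a pole of Perron's kernel, `none` being the one at the origin. -/
noncomputable def polePosition (ℓ : ι → ℝ) (q : Option (Σ _ : ι, ℤ)) : ℂ :=
  q.elim 0 fun q => pole ℓ q.1 q.2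

lemma injOn_polePosition (hpos : ∀ i, 0 < ℓ i)
    (hirr : Pairwise fun i j => Irrational (ℓ i / ℓ j)) :
    InjOn (polePosition ℓ) (enclosedPoles ℓ K R) := by
  rintro (_ | ⟨i, m⟩) hq (_ | ⟨j, n⟩) hq' he
  · rfl
  · exact absurd he.symm (pole_ne_zero (hpos j) (some_mem_enclosedPoles.1 hq').2.1)
  · exact absurd he (pole_ne_zero (hpos i) (some_mem_enclosedPoles.1 hq).2.1)
  · rcases eq_or_ne i j with rfl | hij
    · obtain rfl := pole_injective (hpos i) he
      rfl
    · exact absurd he (pole_ne_pole hpos (hirr hij) (some_mem_enclosedPoles.1 hq).2.1)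

lemma differentiableAt_reducedKernel (hpos : ∀ i, 0 < ℓ i) (hR : 0 < R) {s : ℂ}
    (hs : s ∈ Rectangle (-corner R) (corner R))
    (hne : ∀ q ∈ enclosedPoles ℓ K R, s ≠ polePosition ℓ q) :
    DifferentiableAt ℂ (reducedKernel ℓ K y) s := by
  have hs0 : s ≠ 0 := hne none Finset.none_mem_insertNone
  refine (differentiableAt_perronKernel hs0 fun i hi h0 => ?_).sub
    ((differentiableAt_polarPart _ _ hs0).const_mul _)
  obtain ⟨m, rfl⟩ := exists_eq_pole (hpos i) h0
  have hm : m ≠ 0 := by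
    rintro rfl
    exact hs0 (pole_zero ℓ i)
  exact hne (some ⟨i, m⟩) (some_mem_enclosedPoles.2
    ⟨hi, hm, abs_le_floor_of_pole_mem_rectangle hR (hpos i) hs⟩) rfl

lemma ContourBound.rectIntegral_reducedKernel (h : ContourBound ℓ C R) (K : Finset ι) (y : ℝ) :
    rectIntegral (-corner R) (corner R) (reducedKernel ℓ K y)
      = rectIntegral (-corner R) (corner R) (perronKernel ℓ K y) := by
  have hpolar : ContinuousOn (polarPart (toddSeries ℓ K y) K.card) (contour R) := fun s hs =>
    (differentiableAt_polarPart _ _ (h.ne_zero hs)).continuousAt.continuousWithinAt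
  have hsub : rectIntegral (-corner R) (corner R) (reducedKernel ℓ K y) = _ :=
    rectIntegral_sub h.continuousOn_perronKernel (hpolar.const_mul _)
  rw [hsub, rectIntegral_const_mul, rectIntegral_polarPart _ _ (zero_mem_interior h.pos), mul_zero,
    sub_zero]

variable [DecidableEq ι]

/-- The residue of Perron's kernel at `pole ℓ i m`. -/
noncomputable def poleResidue (ℓ : ι → ℝ) (K : Finset ι) (y : ℝ) (i : ι) (m : ℤ) : ℂ :=
  Complex.exp (pole ℓ i m * y) / (2 * π * I * m) * geomProd ℓ (K.erase i) (pole ℓ i m)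

lemma tendsto_sub_pole_mul_perronKernel (hpos : ∀ i, 0 < ℓ i)
    (hirr : Pairwise fun i j => Irrational (ℓ i / ℓ j)) (hi : i ∈ K) (hm : m ≠ 0) (y : ℝ) :
    Tendsto (fun s => (s - pole ℓ i m) * perronKernel ℓ K y s) (𝓝[≠] pole ℓ i m)
      (𝓝 (poleResidue ℓ K y i m)) := by
  have hcont : ContinuousAt (perronKernel ℓ (K.erase i) y) (pole ℓ i m) :=
    (differentiableAt_perronKernel (pole_ne_zero (hpos i) hm) fun j hj =>
      one_sub_exp_neg_pole_mul_ne_zero hpos (hirr (Finset.ne_of_mem_erase hj).symm) hm).continuousAt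
  have hlim := (tendsto_sub_pole_mul_inv_one_sub_exp (hpos i) m).mul
    (hcont.tendsto.mono_left nhdsWithin_le_nhds)
  convert hlim using 2 with s
  · simp only [perronKernel, geomProd, ← Finset.mul_prod_erase K _ hi]
    ring
  · have hℓ : (ℓ i : ℂ) ≠ 0 := Complex.ofReal_ne_zero.2 (hpos i).ne'
    have hpole : 2 * π * I * m = pole ℓ i m * ℓ i := (div_mul_cancel₀ _ hℓ).symm
    rw [poleResidue, perronKernel, hpole]
    field_simp

lemma tendsto_sub_pole_mul_reducedKernel (hpos : ∀ i, 0 < ℓ i)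
    (hirr : Pairwise fun i j => Irrational (ℓ i / ℓ j)) (hi : i ∈ K) (hm : m ≠ 0) (y : ℝ) :
    Tendsto (fun s => (s - pole ℓ i m) * reducedKernel ℓ K y s) (𝓝[≠] pole ℓ i m)
      (𝓝 (poleResidue ℓ K y i m)) := by
  set g : ℂ → ℂ := fun s => (∏ i ∈ K, (ℓ i : ℂ))⁻¹ * polarPart (toddSeries ℓ K y) K.card s
  have hg : ContinuousAt g (pole ℓ i m) :=
    ((differentiableAt_polarPart _ _ (pole_ne_zero (hpos i) hm)).const_mul _).continuousAt
  have hpolar : Tendsto (fun s => (s - pole ℓ i m) * g s) (𝓝[≠] pole ℓ i m) (𝓝 0) := by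
    have hcont : ContinuousAt (fun s => (s - pole ℓ i m) * g s) (pole ℓ i m) :=
      (continuous_sub_right _).continuousAt.mul hg
    simpa using hcont.tendsto.mono_left nhdsWithin_le_nhds
  have hlim := (tendsto_sub_pole_mul_perronKernel hpos hirr hi hm y).sub hpolar
  rw [sub_zero] at hlim
  exact hlim.congr fun s => (mul_sub _ _ _).symm

theorem ContourBound.perronIntegral_eq (h : ContourBound ℓ C R) (hpos : ∀ i, 0 < ℓ i)
    (hirr : Pairwise fun i j => Irrational (ℓ i / ℓ j)) (K : Finset ι) (y : ℝ) :
    perronIntegral ℓ K y R = mainTerm ℓ K y + ∑ i ∈ K, ∑ k ∈ Finset.Icc 1 ⌊R * ℓ i⌋₊,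
      (poleResidue ℓ K y i k + poleResidue ℓ K y i (-k)) := by
  have hintegral := rectIntegral_eq_sum_residues (f := reducedKernel ℓ K y) (enclosedPoles ℓ K R)
    (polePosition ℓ) (fun q => q.elim (mainTerm ℓ K y : ℂ) fun q => poleResidue ℓ K y q.1 q.2)
    (injOn_polePosition hpos hirr)
    (by
      rintro (_ | ⟨i, m⟩) hq
      · exact zero_mem_interior h.pos
      · exact h.pole_mem_interior (hpos i) (some_mem_enclosedPoles.1 hq).2.2)
    (fun s hs hne => differentiableAt_reducedKernel hpos h.pos hs hne)
    (by
      rintro (_ | ⟨i, m⟩) hq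
      · simpa only [polePosition, Option.elim, sub_zero] using
          tendsto_mul_reducedKernel (fun i _ => (hpos i).ne') y
      · obtain ⟨hi, hm, -⟩ := some_mem_enclosedPoles.1 hq
        exact tendsto_sub_pole_mul_reducedKernel hpos hirr hi hm y)
  rw [perronIntegral, ← h.rectIntegral_reducedKernel, hintegral,
    inv_mul_cancel_left₀ Complex.two_pi_I_ne_zero, enclosedPoles, Finset.sum_insertNone,
    Finset.sum_sigma]
  simp only [Option.elim, sum_Icc_neg_erase_zero]

end PerronResidues

section CotangentSeries

variable {ι : Type*} {ℓ : ι → ℝ} {K J : Finset ι} {i j : ι} {m : ℤ} {C R y : ℝ}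

lemma inv_one_sub_exp_neg_pole_mul (h : 1 - Complex.exp (-(pole ℓ i m * ℓ j)) ≠ 0) :
    (1 - Complex.exp (-(pole ℓ i m * ℓ j)))⁻¹ = (1 + -I * cot (π * m * ℓ j / ℓ i)) / 2 := by
  set t : ℝ := π * m * ℓ j / ℓ i with ht
  have hexp : -(pole ℓ i m * ℓ j) = 2 * I * (-t : ℝ) := by
    rw [pole, ht]
    push_cast
    ring
  have hcot := Complex.cot_eq_exp_ratio (-t : ℝ)
  rw [← hexp, ← Complex.ofReal_cot, Real.cot_eq_cos_div_sin, cos_neg, sin_neg, div_neg,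
    ← Real.cot_eq_cos_div_sin, Complex.ofReal_neg] at hcot
  rw [neg_mul_comm, hcot]
  field_simp
  ring

lemma neg_I_pow (n : ℕ) : (-I) ^ n = Complex.exp ((-(n * (π / 2)) : ℝ) * I) := by
  rw [← Complex.exp_neg_pi_div_two_mul_I, ← Complex.exp_nat_mul]
  push_cast
  ring_nf

lemma geomProd_pole (h : ∀ j ∈ K, 1 - Complex.exp (-(pole ℓ i m * ℓ j)) ≠ 0) :
    geomProd ℓ K (pole ℓ i m) = (2 ^ K.card)⁻¹ * ∑ J ∈ K.powerset,
      Complex.exp ((-(J.card * (π / 2)) : ℝ) * I) * (∏ j ∈ J, cot (π * m * ℓ j / ℓ i) : ℝ) := by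
  rw [geomProd, Finset.prod_congr rfl fun j hj => inv_one_sub_exp_neg_pole_mul (h j hj),
    Finset.prod_div_distrib, Finset.prod_const, Finset.prod_one_add, div_eq_inv_mul]
  simp only [Finset.prod_mul_distrib, Finset.prod_const, neg_I_pow, Complex.ofReal_prod]

lemma pole_neg (ℓ : ι → ℝ) (i : ι) (m : ℤ) : pole ℓ i (-m) = conj (pole ℓ i m) := by
  rw [pole_eq, pole_eq, map_mul, Complex.conj_ofReal, Complex.conj_I]
  push_cast
  ring

lemma geomProd_conj (ℓ : ι → ℝ) (K : Finset ι) (s : ℂ) :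
    geomProd ℓ K (conj s) = conj (geomProd ℓ K s) := by
  simp [geomProd, map_prod, ← Complex.exp_conj]

/-- The partial sum up to `R * ℓ i` of the series with the cotangents of `J`, whose terms are up to
sign sines or cosines according to the parity of `J`. -/
noncomputable def cotSeries (ℓ : ι → ℝ) (y : ℝ) (i : ι) (J : Finset ι) (R : ℝ) : ℝ :=
  ∑ k ∈ Finset.Icc 1 ⌊R * ℓ i⌋₊,
    sin (2 * π * k * (y / ℓ i) - J.card * (π / 2)) * (∏ j ∈ J, cot (π * k * ℓ j / ℓ i)) / k

variable [DecidableEq ι]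

/-- The sum over `i ∈ M` of the cotangent series to the base `ℓ i` with the cotangents of the other
elements of `M`; only such sums converge in general. -/
noncomputable def symSeries (ℓ : ι → ℝ) (y : ℝ) (M : Finset ι) (R : ℝ) : ℝ :=
  ∑ i ∈ M, cotSeries ℓ y i (M.erase i) R

lemma poleResidue_neg (ℓ : ι → ℝ) (K : Finset ι) (y : ℝ) (i : ι) (m : ℤ) :
    poleResidue ℓ K y i (-m) = conj (poleResidue ℓ K y i m) := by
  simp [poleResidue, pole_neg, geomProd_conj, ← Complex.exp_conj, Complex.conj_ofNat]

lemma exp_div_mul_I_mul_re (α β p q : ℝ) :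
    (Complex.exp (α * I) / (q * I) * (Complex.exp (β * I) * p)).re = sin (α + β) * p / q := by
  have hsplit : Complex.exp (α * I) / (q * I) * (Complex.exp (β * I) * p) =
      Complex.exp ((α + β : ℝ) * I) * (p / q : ℝ) / I := by
    push_cast
    rw [add_mul, Complex.exp_add]
    ring
  rw [hsplit, Complex.div_I, Complex.neg_re, Complex.mul_I_re, neg_neg, Complex.im_mul_ofReal,
    Complex.exp_ofReal_mul_I_im, mul_div_assoc]

lemma poleResidue_add_neg (hpos : ∀ i, 0 < ℓ i)
    (hirr : Pairwise fun i j => Irrational (ℓ i / ℓ j)) (K : Finset ι) (y : ℝ) (i : ι) {k : ℕ}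
    (hk : k ≠ 0) :
    poleResidue ℓ K y i k + poleResidue ℓ K y i (-k) =
      ((2 ^ (K.erase i).card * π)⁻¹ * ∑ J ∈ (K.erase i).powerset,
        sin (2 * π * k * (y / ℓ i) - J.card * (π / 2)) * (∏ j ∈ J, cot (π * k * ℓ j / ℓ i)) / k
          : ℝ) := by
  have hgeom := geomProd_pole (m := k) fun j (hj : j ∈ K.erase i) =>
    one_sub_exp_neg_pole_mul_ne_zero hpos (hirr (Finset.ne_of_mem_erase hj).symm)
      (Nat.cast_ne_zero.2 hk)
  have harg : pole ℓ i k * y = (2 * π * k * (y / ℓ i) : ℝ) * I := by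
    rw [pole]
    push_cast
    ring
  have hden : 2 * π * I * ((k : ℤ) : ℂ) = (2 * π * k : ℝ) * I := by
    push_cast
    ring
  have hscalar : ((2 : ℂ) ^ (K.erase i).card)⁻¹ = (((2 ^ (K.erase i).card)⁻¹ : ℝ) : ℂ) := by
    push_cast
    rfl
  rw [poleResidue_neg, Complex.add_conj, poleResidue, hgeom, harg, hden, hscalar, mul_left_comm,
    Complex.re_ofReal_mul, Finset.mul_sum, Complex.re_sum]
  simp only [exp_div_mul_I_mul_re, Int.cast_natCast, ← sub_eq_add_neg]
  simp only [Finset.mul_sum]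
  congr 1
  refine Finset.sum_congr rfl fun J _ => ?_
  field_simp

lemma sum_sum_powerset_erase {A : Type*} [AddCommMonoid A] (K : Finset ι) (F : ι → Finset ι → A) :
    ∑ i ∈ K, ∑ J ∈ (K.erase i).powerset, F i J = ∑ M ∈ K.powerset, ∑ i ∈ M, F i (M.erase i) := by
  rw [Finset.sum_sigma', Finset.sum_sigma']
  refine Finset.sum_bij' (fun q _ => ⟨insert q.1 q.2, q.1⟩) (fun q _ => ⟨q.2, q.1.erase q.2⟩)
    ?_ ?_ ?_ ?_ ?_
  all_goals
    simp only [Finset.mem_sigma, Finset.mem_powerset, Sigma.forall, and_imp]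
    intro _ _ h₁ h₂
  · exact ⟨Finset.insert_subset h₁ (h₂.trans (Finset.erase_subset _ _)),
      Finset.mem_insert_self _ _⟩
  · exact ⟨h₁ h₂, Finset.erase_subset_erase _ h₁⟩
  · rw [Finset.erase_insert fun h => Finset.notMem_erase _ _ (h₂ h)]
  · rw [Finset.insert_erase h₂]
  · rw [Finset.erase_insert fun h => Finset.notMem_erase _ _ (h₂ h)]

theorem ContourBound.perronIntegral_eq_sum_symSeries (h : ContourBound ℓ C R) (hpos : ∀ i, 0 < ℓ i)
    (hirr : Pairwise fun i j => Irrational (ℓ i / ℓ j)) (K : Finset ι) (y : ℝ) :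
    perronIntegral ℓ K y R =
      (mainTerm ℓ K y + (2 ^ (K.card - 1) * π)⁻¹ * ∑ M ∈ K.powerset, symSeries ℓ y M R : ℝ) := by
  have hregroup : ∑ M ∈ K.powerset, symSeries ℓ y M R = _ :=
    (sum_sum_powerset_erase K fun i J => cotSeries ℓ y i J R).symm
  rw [h.perronIntegral_eq hpos hirr, Complex.ofReal_add, hregroup, Finset.mul_sum,
    Complex.ofReal_sum]
  congr 1
  refine Finset.sum_congr rfl fun i hi => ?_
  simp only [cotSeries]
  rw [Finset.sum_comm, Finset.mul_sum, Complex.ofReal_sum]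
  refine Finset.sum_congr rfl fun k hk => ?_
  have hk0 : k ≠ 0 := Nat.one_le_iff_ne_zero.1 (Finset.mem_Icc.1 hk).1
  rw [poleResidue_add_neg hpos hirr K y i hk0, Finset.card_erase_of_mem hi]

end CotangentSeries

section Cutoffs

variable {ι : Type*} {ℓ : ι → ℝ} {δ : ℝ}

/-- The real numbers at distance at least `δ` from all `k / ℓ i` with `k` a natural number: the
points where some cut-off `⌊R * ℓ i⌋₊` jumps. -/
def cutoffs (ℓ : ι → ℝ) (δ : ℝ) : Set ℝ := {R | ∀ i, ∀ k : ℕ, δ ≤ |R - k / ℓ i|}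

lemma isAdmissible_cutoffs (hpos : ∀ i, 0 < ℓ i) (hδ : 0 < δ) :
    IsAdmissible ℓ (atTop ⊓ 𝓟 (cutoffs ℓ δ)) where
  le_atTop := inf_le_left
  avoids i := by
    have hi := hpos i
    refine ⟨δ * ℓ i, mul_pos hδ hi, ?_⟩
    filter_upwards [mem_inf_of_right (mem_principal_self _),
      mem_inf_of_left (eventually_ge_atTop δ)] with R hR hδR k
    obtain ⟨n, rfl | rfl⟩ := k.eq_nat_or_neg
    · have hscale : R * ℓ i - (n : ℤ) = (R - n / ℓ i) * ℓ i := by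
        push_cast
        field_simp
      rw [hscale, abs_mul, abs_of_pos hi]
      exact mul_le_mul_of_nonneg_right (hR i n) hi.le
    · calc δ * ℓ i ≤ R * ℓ i := mul_le_mul_of_nonneg_right hδR hi.le
        _ ≤ R * ℓ i - (-n : ℤ) := by
          push_cast
          linarith [n.cast_nonneg (α := ℝ)]
        _ ≤ _ := le_abs_self _

lemma inv_le_abs_natCast_div_sub {u : ℝ} (hu : 0 < u) {j k : ℕ} (hjk : j ≠ k) :
    u⁻¹ ≤ |(j : ℝ) / u - k / u| := by
  have hone : (1 : ℝ) ≤ |(j : ℝ) - k| := by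
    exact_mod_cast Int.one_le_abs (sub_ne_zero.2 (Nat.cast_injective.ne hjk : (j : ℤ) ≠ k))
  rw [← sub_div, abs_div, abs_of_pos hu, inv_eq_one_div]
  gcongr

-- An interval of length `h ≤ 1 / (2 * u)` cannot have points `k / u` close to both of its ends.
lemma exists_subinterval {u h : ℝ} (hu : 0 < u) (hh : 0 < h) (hhu : 2 * h ≤ u⁻¹) (x : ℝ) :
    ∃ x', x ≤ x' ∧ x' + h / 4 ≤ x + h ∧
      ∀ r ∈ Icc x' (x' + h / 4), ∀ k : ℕ, h / 4 ≤ |r - k / u| := by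
  by_cases hleft : ∃ k : ℕ, x - h / 4 < (k : ℝ) / u ∧ (k : ℝ) / u < x + h / 2
  · obtain ⟨k, hk₁, hk₂⟩ := hleft
    refine ⟨x + 3 * h / 4, by linarith, by linarith, fun r hr j => ?_⟩
    rcases eq_or_ne j k with rfl | hjk
    · exact (by linarith [hr.1] : h / 4 ≤ r - j / u).trans (le_abs_self _)
    · have hsep := hhu.trans (inv_le_abs_natCast_div_sub hu hjk)
      by_contra! hlt
      rw [abs_lt] at hlt
      rcases le_abs.1 hsep with hsep | hsep <;> linarith [hr.1, hr.2]
  · push Not at hleft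
    refine ⟨x, le_rfl, by linarith, fun r hr j => ?_⟩
    rcases le_or_gt ((j : ℝ) / u) (x - h / 4) with hj | hj
    · exact (by linarith [hr.1] : h / 4 ≤ r - j / u).trans (le_abs_self _)
    · exact (by linarith [hleft j hj, hr.2] : h / 4 ≤ -(r - j / u)).trans (neg_le_abs _)

lemma exists_uniform_subinterval (hpos : ∀ i, 0 < ℓ i) (s : Finset ι) :
    ∃ h > 0, ∀ x, ∃ x' ≥ x, ∀ r ∈ Icc x' (x' + h), ∀ i ∈ s, ∀ k : ℕ, h ≤ |r - k / ℓ i| := by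
  classical
  induction s using Finset.induction_on with
  | empty => exact ⟨1, one_pos, fun x => ⟨x, le_rfl, by simp⟩⟩
  | insert i s _ ih =>
    obtain ⟨h, hh, hs⟩ := ih
    have hi := hpos i
    set g := min h ((ℓ i)⁻¹ / 2) with hg
    have hg_pos : 0 < g := lt_min hh (by positivity)
    have hgh : g ≤ h := min_le_left _ _
    refine ⟨g / 4, by positivity, fun x => ?_⟩
    obtain ⟨x₁, hx₁, hs₁⟩ := hs x
    obtain ⟨x₂, hx₂, hx₂', hi₂⟩ :=
      exists_subinterval hi hg_pos (by linarith [min_le_right h ((ℓ i)⁻¹ / 2)]) x₁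
    refine ⟨x₂, hx₁.trans hx₂, fun r hr j hj k => ?_⟩
    obtain rfl | hj := Finset.mem_insert.1 hj
    · exact hi₂ r hr k
    · have hr₁ : r ∈ Icc x₁ (x₁ + h) := ⟨hx₂.trans hr.1, by linarith [hr.2]⟩
      linarith [hs₁ r hr₁ j hj k]

lemma exists_cutoffs_neBot [Finite ι] (hpos : ∀ i, 0 < ℓ i) :
    ∃ δ₀ > 0, ∀ δ ≤ δ₀, (atTop ⊓ 𝓟 (cutoffs ℓ δ)).NeBot := by
  have := Fintype.ofFinite ι
  obtain ⟨h, hh, hsub⟩ := exists_uniform_subinterval hpos Finset.univ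
  refine ⟨h, hh, fun δ hδ => Filter.inf_principal_neBot_iff.2 fun U hU => ?_⟩
  obtain ⟨X, hX⟩ := mem_atTop_sets.1 hU
  obtain ⟨R, hXR, hR⟩ := hsub X
  exact ⟨R, hX R hXR, fun i k =>
    hδ.trans (hR R ⟨le_rfl, by linarith⟩ i (Finset.mem_univ i) k)⟩

end Cutoffs

section MainTerm

lemma coeff_mul_eq_sum_range (p q : ℝ⟦X⟧) (n : ℕ) :
    (p * q).coeff n = ∑ k ∈ Finset.range (n + 1), p.coeff k * q.coeff (n - k) := by
  rw [PowerSeries.coeff_mul, Finset.Nat.sum_antidiagonal_eq_sum_range_succ_mk]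

lemma coeff_rescale_bernoulli'PowerSeries (c : ℝ) (n : ℕ) :
    (PowerSeries.rescale c (bernoulli'PowerSeries ℝ)).coeff n =
      c ^ n * (bernoulli' n / n.factorial : ℚ) := by
  simp [bernoulli'PowerSeries]

lemma coeff_rescale_exp (y : ℝ) (n : ℕ) :
    (PowerSeries.rescale y (PowerSeries.exp ℝ)).coeff n = y ^ n / n.factorial := by
  simp [PowerSeries.coeff_exp, div_eq_mul_inv]

lemma mainTerm_singleton {ι : Type*} {ℓ : ι → ℝ} {i : ι} (hi : 0 < ℓ i) (y : ℝ) :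
    mainTerm ℓ {i} y = y / ℓ i + 1 / 2 := by
  have hcoeff : (toddSeries ℓ {i} y).coeff 1 = y + ℓ i / 2 := by
    rw [toddSeries, Finset.prod_singleton, coeff_mul_eq_sum_range, Finset.sum_range_succ,
      Finset.sum_range_one]
    simp only [coeff_rescale_exp, coeff_rescale_bernoulli'PowerSeries, Nat.factorial]
    norm_num
    ring
  rw [mainTerm, Finset.card_singleton, hcoeff, Finset.prod_singleton]
  field_simp

lemma mainTerm_univ_eq_mainPoly {u : Fin 4 → ℝ} (hu : ∀ i, log (u i) ≠ 0) (x : ℝ) :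
    mainTerm (fun i => log (u i)) Finset.univ (log x) =
      mainPoly (u 0) (u 1) (u 2) (u 3) x := by
  have h₀ := hu 0
  have h₁ := hu 1
  have h₂ := hu 2
  have h₃ := hu 3
  rw [mainTerm, toddSeries, mainPoly, Finset.card_fin, Fin.prod_univ_four, Fin.prod_univ_four]
  simp only [coeff_mul_eq_sum_range, Finset.sum_range_succ, Finset.sum_range_zero,
    coeff_rescale_exp, coeff_rescale_bernoulli'PowerSeries, bernoulli'_zero, bernoulli'_one,
    bernoulli'_two, bernoulli'_three, Nat.factorial, Nat.reduceSub]
  norm_num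
  field_simp
  ring

end MainTerm

section Limits

variable {ι : Type*} {ℓ : ι → ℝ} {K : Finset ι} {l : Filter ℝ} {y : ℝ}

lemma ncard_exponents_singleton (ℓ : ι → ℝ) (i : ι) (s : Set ℝ) :
    (exponents ℓ {i} s).ncard = {n : ℕ | n * ℓ i ∈ s}.ncard := by
  classical
  have himage : exponents ℓ {i} s = Pi.single i '' {n : ℕ | n * ℓ i ∈ s} := by
    ext e
    simp only [exponents, Finset.sum_singleton, Finset.mem_singleton, Set.mem_ofPred_eq, mem_image]
    constructor
    · rintro ⟨he, hs⟩
      exact ⟨e i, hs, funext fun j => by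
        obtain rfl | hj := eq_or_ne j i
        · simp
        · simp [hj, he j hj]⟩
    · rintro ⟨n, hn, rfl⟩
      exact ⟨fun j hj => by simp [hj], by simpa using hn⟩
  rw [himage, ncard_image_of_injective _ (Pi.single_injective i)]

lemma floor_add_one_add_ceil {t : ℝ} (ht : 0 ≤ t) :
    ((⌊t⌋₊ + 1 + ⌈t⌉₊ : ℕ) : ℝ) / 2 = t + 1 / 2 - B1star t := by
  push_cast
  rw [natCast_floor_eq_intCast_floor ht, natCast_ceil_eq_intCast_ceil ht, B1star]
  split_ifs with hinteger
  · obtain ⟨n, rfl⟩ := hinteger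
    rw [Int.floor_intCast, Int.ceil_intCast]
    ring
  · rw [(Int.ceil_eq_floor_add_one_iff_notMem t).2 hinteger, Int.fract]
    push_cast
    ring

lemma weightedCount_singleton {i : ι} (hi : 0 < ℓ i) (hy : 0 ≤ y) :
    weightedCount ℓ {i} y = y / ℓ i + 1 / 2 - B1star (y / ℓ i) := by
  have hIic : {n : ℕ | n * ℓ i ∈ Iic y} = Finset.range (⌊y / ℓ i⌋₊ + 1) := by
    ext n
    simp [Nat.le_floor_iff (div_nonneg hy hi.le), le_div_iff₀ hi]
  have hIio : {n : ℕ | n * ℓ i ∈ Iio y} = Finset.range ⌈y / ℓ i⌉₊ := by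
    ext n
    simp [Nat.lt_ceil, lt_div_iff₀ hi]
  rw [weightedCount, ncard_exponents_singleton, ncard_exponents_singleton, hIic, hIio,
    ncard_coe_finset, ncard_coe_finset, Finset.card_range, Finset.card_range, ← Nat.cast_add,
    floor_add_one_add_ceil (div_nonneg hy hi.le)]

variable [DecidableEq ι]

lemma IsAdmissible.tendsto_sum_symSeries [Finite ι] (hl : IsAdmissible ℓ l) (hpos : ∀ i, 0 < ℓ i)
    (hirr : Pairwise fun i j => Irrational (ℓ i / ℓ j)) (hK : K.Nonempty) (hy : 0 ≤ y) :
    Tendsto (fun R => ∑ M ∈ K.powerset, symSeries ℓ y M R) l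
      (𝓝 (2 ^ (K.card - 1) * π * (weightedCount ℓ K y - mainTerm ℓ K y))) := by
  obtain ⟨C, hC⟩ := hl.exists_contourBound hpos
  have hy' : -∑ i ∈ K, ℓ i < y :=
    (neg_neg_of_pos (Finset.sum_pos (fun i _ => hpos i) hK)).trans_le hy
  have hre := (Complex.continuous_re.tendsto _).comp (hl.tendsto_perronIntegral hpos hK hy')
  refine ((hre.sub_const (mainTerm ℓ K y)).const_mul (2 ^ (K.card - 1) * π)).congr' ?_
  filter_upwards [hC] with R hR
  have hscale : (2 ^ (K.card - 1) * π : ℝ) ≠ 0 := by positivity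
  rw [Function.comp_apply, hR.perronIntegral_eq_sum_symSeries hpos hirr, Complex.ofReal_re,
    add_sub_cancel_left, mul_inv_cancel_left₀ hscale]

/-- The limit of the series `symSeries ℓ y M`, defined by the recursion on the subsets of `M` that
Perron's formula imposes. -/
noncomputable def symLimit (ℓ : ι → ℝ) (y : ℝ) (M : Finset ι) : ℝ :=
  if M = ∅ then 0 else
    2 ^ (M.card - 1) * π * (weightedCount ℓ M y - mainTerm ℓ M y) -
      ∑ N : M.ssubsets, symLimit ℓ y N
termination_by M.card
decreasing_by exact Finset.card_lt_card (Finset.mem_ssubsets.1 N.2)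

lemma symLimit_empty (ℓ : ι → ℝ) (y : ℝ) : symLimit ℓ y ∅ = 0 := by rw [symLimit, if_pos rfl]

lemma symLimit_of_nonempty (hK : K.Nonempty) (ℓ : ι → ℝ) (y : ℝ) :
    symLimit ℓ y K = 2 ^ (K.card - 1) * π * (weightedCount ℓ K y - mainTerm ℓ K y) -
      ∑ N ∈ K.ssubsets, symLimit ℓ y N := by
  rw [symLimit, if_neg hK.ne_empty, Finset.sum_coe_sort K.ssubsets (symLimit ℓ y)]

lemma sum_powerset_symLimit (hK : K.Nonempty) (ℓ : ι → ℝ) (y : ℝ) :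
    ∑ M ∈ K.powerset, symLimit ℓ y M =
      2 ^ (K.card - 1) * π * (weightedCount ℓ K y - mainTerm ℓ K y) := by
  rw [← Finset.add_sum_erase _ _ (Finset.mem_powerset_self K), ← Finset.ssubsets,
    symLimit_of_nonempty hK, sub_add_cancel]

theorem IsAdmissible.tendsto_symSeries [Finite ι] (hl : IsAdmissible ℓ l)
    (hpos : ∀ i, 0 < ℓ i) (hirr : Pairwise fun i j => Irrational (ℓ i / ℓ j)) (hy : 0 ≤ y)
    (M : Finset ι) : Tendsto (symSeries ℓ y M) l (𝓝 (symLimit ℓ y M)) := by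
  induction M using Finset.strongInduction with
  | H M ih =>
    obtain rfl | hM := M.eq_empty_or_nonempty
    · rw [symLimit_empty]
      exact tendsto_const_nhds.congr fun R => by simp [symSeries]
    rw [symLimit_of_nonempty hM]
    refine ((hl.tendsto_sum_symSeries hpos hirr hM hy).sub
      (tendsto_finsetSum M.ssubsets fun N hN => ih N (Finset.mem_ssubsets.1 hN))).congr fun R => ?_
    rw [Finset.ssubsets, sub_eq_iff_eq_add,
      Finset.add_sum_erase _ (symSeries ℓ y · R) (Finset.mem_powerset_self M)]

theorem symLimit_singleton {i : ι} (hi : 0 < ℓ i) (hy : 0 ≤ y) :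
    symLimit ℓ y {i} = -π * B1star (y / ℓ i) := by
  have hss : ({i} : Finset ι).ssubsets = {∅} := by
    ext N
    simp
  rw [symLimit_of_nonempty (Finset.singleton_nonempty i), hss, Finset.sum_singleton, symLimit_empty,
    weightedCount_singleton hi hy, mainTerm_singleton hi y, Finset.card_singleton]
  ring

end Limits

section MultiplicativeIndependence

variable {ι : Type*} [Fintype ι] {u : ι → ℕ} {x : ℝ}

lemma prod_pow_single [DecidableEq ι] (u : ι → ℕ) (i : ι) (n : ℕ) :
    ∏ j, u j ^ (Pi.single i n : ι → ℕ) j = u i ^ n := by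
  rw [Fintype.prod_eq_single i fun j hj => by rw [Pi.single_eq_of_ne hj, pow_zero],
    Pi.single_eq_same]

lemma two_le_of_injective_prod_pow (hu : Function.Injective fun e : ι → ℕ => ∏ i, u i ^ e i)
    (i : ι) : 2 ≤ u i := by
  classical
  by_contra! hlt
  have hpow : u i ^ 1 = u i ^ 2 := by interval_cases u i <;> rfl
  have hsingle : (Pi.single i 1 : ι → ℕ) = Pi.single i 2 :=
    hu (by simpa only [prod_pow_single] using hpow)
  exact absurd (Pi.single_injective i hsingle) (by decide)

lemma log_pos_of_injective_prod_pow (hu : Function.Injective fun e : ι → ℕ => ∏ i, u i ^ e i)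
    (i : ι) : 0 < log (u i) :=
  log_pos (Nat.one_lt_cast.2 (two_le_of_injective_prod_pow hu i))

lemma irrational_log_div_log_of_injective_prod_pow
    (hu : Function.Injective fun e : ι → ℕ => ∏ i, u i ^ e i) :
    Pairwise fun i j => Irrational (log (u i) / log (u j)) := by
  classical
  rintro i j hij ⟨q, hq⟩
  have hi := log_pos_of_injective_prod_pow hu i
  have hj := log_pos_of_injective_prod_pow hu j
  have hq0 : 0 ≤ q := by exact_mod_cast hq ▸ (div_pos hi hj).le
  have hlog : q.den * log (u i) = q.num.toNat * log (u j) := by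
    have hnum : (q.num.toNat : ℝ) = q.num := by
      exact_mod_cast Int.toNat_of_nonneg (Rat.num_nonneg.2 hq0)
    rw [Rat.cast_def, div_eq_div_iff (Nat.cast_ne_zero.2 q.den_ne_zero) hj.ne'] at hq
    rw [hnum, hq, mul_comm]
  have hpow : u i ^ q.den = u j ^ q.num.toNat := by
    have hpos (i : ι) (n : ℕ) : (0 : ℝ) < u i ^ n :=
      pow_pos (Nat.cast_pos.2 (two_pos.trans_le (two_le_of_injective_prod_pow hu i))) n
    rw [← Real.log_pow, ← Real.log_pow] at hlog
    exact_mod_cast log_injOn_pos (hpos i _) (hpos j _) hlog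
  have hsingle : (Pi.single i q.den : ι → ℕ) = Pi.single j q.num.toNat :=
    hu (by simpa only [prod_pow_single] using hpow)
  have hden := congrFun hsingle i
  rw [Pi.single_eq_same, Pi.single_eq_of_ne hij] at hden
  exact q.den_ne_zero hden

lemma sum_mul_log (hu : ∀ i, 2 ≤ u i) (e : ι → ℕ) :
    ∑ i, e i * log (u i) = log (∏ i, u i ^ e i : ℕ) := by
  push_cast
  rw [log_prod fun i _ => pow_ne_zero _ (Nat.cast_ne_zero.2 (two_pos.trans_le (hu i)).ne')]
  simp only [log_pow]

lemma mem_exponents_log (hu : ∀ i, 2 ≤ u i) (e : ι → ℕ) (s : Set ℝ) :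
    e ∈ exponents (fun i => log (u i)) Finset.univ s ↔ log (∏ i, u i ^ e i : ℕ) ∈ s := by
  simp only [exponents, Finset.mem_univ, not_true_eq_false, false_imp_iff, implies_true, true_and,
    Set.mem_ofPred_eq, sum_mul_log hu]

lemma ncard_le_eq_ncard_lt_add_indicator {α : Type*} {m : α → ℝ} (hm : Function.Injective m)
    {x : ℝ} (hfin : {e | m e ≤ x}.Finite) :
    ({e | m e ≤ x}.ncard : ℝ) = {e | m e < x}.ncard + (range m).indicator 1 x := by
  have hunion : {e | m e ≤ x} = {e | m e < x} ∪ m ⁻¹' {x} := by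
    ext e
    exact le_iff_lt_or_eq (a := m e) (b := x)
  have hdisj : Disjoint {e | m e < x} (m ⁻¹' {x}) :=
    Set.disjoint_left.2 fun e hlt heq => (ne_of_lt hlt) heq
  rw [hunion] at hfin
  rw [hunion, ncard_union_eq hdisj (hfin.subset subset_union_left)
    (hfin.subset subset_union_right), Nat.cast_add]
  congr 1
  by_cases hx : x ∈ range m
  · obtain ⟨e, rfl⟩ := hx
    rw [← image_singleton, preimage_image_eq _ hm, ncard_singleton,
      indicator_of_mem (mem_range_self e), Nat.cast_one, Pi.one_apply]
  · rw [preimage_singleton_eq_empty.2 hx, ncard_empty, indicator_of_notMem hx, Nat.cast_zero]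

lemma weightedCount_log (hu : Function.Injective fun e : ι → ℕ => ∏ i, u i ^ e i) (hx : 0 < x) :
    weightedCount (fun i => log (u i)) Finset.univ (log x) =
      {e : ι → ℕ | ((∏ i, u i ^ e i : ℕ) : ℝ) ≤ x}.ncard -
        (range fun e : ι → ℕ => ((∏ i, u i ^ e i : ℕ) : ℝ)).indicator 1 x / 2 := by
  have htwo := two_le_of_injective_prod_pow hu
  have hpos (e : ι → ℕ) : (0 : ℝ) < (∏ i, u i ^ e i : ℕ) :=
    Nat.cast_pos.2 (Finset.prod_pos fun i _ => pow_pos (two_pos.trans_le (htwo i)) _)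
  have hIic : exponents (fun i => log (u i)) Finset.univ (Iic (log x)) =
      {e | ((∏ i, u i ^ e i : ℕ) : ℝ) ≤ x} :=
    Set.ext fun e => (mem_exponents_log htwo e _).trans (log_le_log_iff (hpos e) hx)
  have hIio : exponents (fun i => log (u i)) Finset.univ (Iio (log x)) =
      {e | ((∏ i, u i ^ e i : ℕ) : ℝ) < x} :=
    Set.ext fun e => (mem_exponents_log htwo e _).trans (log_lt_log_iff (hpos e) hx)
  have hfin : {e : ι → ℕ | ((∏ i, u i ^ e i : ℕ) : ℝ) ≤ x}.Finite :=
    hIic ▸ finite_exponents (log_pos_of_injective_prod_pow hu) bddAbove_Iic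
  have hncard := ncard_le_eq_ncard_lt_add_indicator (Nat.cast_injective.comp hu) hfin
  simp only [Function.comp_def] at hncard
  rw [weightedCount, hIic, hIio, hncard]
  ring

end MultiplicativeIndependence

section Series

variable {ι : Type*} {ℓ : ι → ℝ} {v : ι → ℝ} {i j m : ι} {l : Filter ℝ} {x y R : ℝ}

lemma sin_pi_mul_natCast_mul_div_ne_zero {s t : ℝ} (h : Irrational (s / t)) {k : ℕ} (hk : k ≠ 0) :
    sin (π * k * s / t) ≠ 0 := by
  rw [mul_div_assoc, mul_assoc, Ne, sin_eq_zero_iff]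
  rintro ⟨n, hn⟩
  rw [mul_comm π] at hn
  exact (h.natCast_mul hk).ne_int n (mul_right_cancel₀ pi_ne_zero hn).symm

lemma sum_cos_div_sin_eq_cotSeries (hij : Irrational (ℓ j / ℓ i)) :
    ∑ k ∈ Finset.Icc 1 ⌊R * ℓ i⌋₊,
        cos (2 * π * k * ((y - 1 / 2 * ℓ j) / ℓ i)) / (k * sin (π * k * ℓ j / ℓ i)) =
      cotSeries ℓ y i ∅ R - cotSeries ℓ y i {j} R := by
  rw [cotSeries, cotSeries, ← Finset.sum_sub_distrib]
  refine Finset.sum_congr rfl fun k hk => ?_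
  have hk₀ : k ≠ 0 := Nat.one_le_iff_ne_zero.1 (Finset.mem_Icc.1 hk).1
  have hsin := sin_pi_mul_natCast_mul_div_ne_zero hij hk₀
  have harg : 2 * π * k * ((y - 1 / 2 * ℓ j) / ℓ i) =
      2 * π * k * (y / ℓ i) - π * k * ℓ j / ℓ i := by ring
  rw [harg, cos_sub, Finset.card_empty, Finset.card_singleton, Finset.prod_empty,
    Finset.prod_singleton, Nat.cast_zero, Nat.cast_one, zero_mul, sub_zero, one_mul,
    sin_sub_pi_div_two, Real.cot_eq_cos_div_sin]
  field_simp
  ring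

lemma doubleSineSum_eq_cotSeries [DecidableEq ι] (hjm : j ≠ m)
    (hij : Irrational (log (v j) / log (v i))) (him : Irrational (log (v m) / log (v i))) :
    doubleSineSum (v i) (v j) (v m) x R =
      2 * cotSeries (fun i => log (v i)) (log x) i ∅ R -
        2 * cotSeries (fun i => log (v i)) (log x) i {j, m} R := by
  rw [doubleSineSum, cotSeries, cotSeries, Finset.mul_sum, Finset.mul_sum,
    ← Finset.sum_sub_distrib]
  refine Finset.sum_congr rfl fun k hk => ?_
  have hk₀ : k ≠ 0 := Nat.one_le_iff_ne_zero.1 (Finset.mem_Icc.1 hk).1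
  have hsinj := sin_pi_mul_natCast_mul_div_ne_zero hij hk₀
  have hsinm := sin_pi_mul_natCast_mul_div_ne_zero him hk₀
  have hadd : 2 * π * k * ((log x + 1 / 2 * log (v j) - 1 / 2 * log (v m)) / log (v i)) =
      2 * π * k * (log x / log (v i)) +
        (π * k * log (v j) / log (v i) - π * k * log (v m) / log (v i)) := by ring
  have hsub : 2 * π * k * ((log x - 1 / 2 * log (v j) + 1 / 2 * log (v m)) / log (v i)) =
      2 * π * k * (log x / log (v i)) -
        (π * k * log (v j) / log (v i) - π * k * log (v m) / log (v i)) := by ring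
  rw [hadd, hsub, sin_add, sin_sub (2 * π * k * (log x / log (v i))), cos_sub, Finset.card_empty,
    Finset.card_pair hjm, Finset.prod_empty, Finset.prod_pair hjm, Nat.cast_zero, zero_mul,
    sub_zero, Nat.cast_two, mul_div_cancel₀ π two_ne_zero, sin_sub_pi, Real.cot_eq_cos_div_sin,
    Real.cot_eq_cos_div_sin]
  field_simp
  ring

lemma tripleCotSum_eq_cotSeries [DecidableEq ι] {n : ι} (hjm : j ≠ m) (hjn : j ≠ n) (hmn : m ≠ n) :
    tripleCotSum (v i) (v j) (v m) (v n) x R =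
      cotSeries (fun i => log (v i)) (log x) i {j, m, n} R := by
  have hcard : ({j, m, n} : Finset ι).card = 3 :=
    Finset.card_eq_three.2 ⟨j, m, n, hjm, hjn, hmn, rfl⟩
  have hshift (t : ℝ) : sin (t - (3 : ℕ) * (π / 2)) = cos t := by
    rw [show t - (3 : ℕ) * (π / 2) = t + π / 2 - 2 * π by push_cast; ring, sin_sub_two_pi,
      sin_add_pi_div_two]
  rw [tripleCotSum, cotSeries]
  refine Finset.sum_congr rfl fun k _ => ?_
  rw [hcard, hshift, Finset.prod_insert (by simp [hjm, hjn]), Finset.prod_pair hmn]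
  simp only [Real.cot_eq_cos_div_sin, div_eq_mul_inv, mul_inv]
  ring

lemma tripleCotQuadruple_eq_symSeries {v : Fin 4 → ℝ} :
    tripleCotQuadruple (v 0) (v 1) (v 2) (v 3) x R =
      symSeries (fun i => log (v i)) (log x) Finset.univ R := by
  have herase : ∀ i : Fin 4,
      Finset.univ.erase i = ![{1, 2, 3}, {0, 2, 3}, {0, 1, 3}, {0, 1, 2}] i := by
    decide
  rw [tripleCotQuadruple, tripleCotSum_eq_cotSeries (by decide) (by decide) (by decide),
    tripleCotSum_eq_cotSeries (by decide) (by decide) (by decide),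
    tripleCotSum_eq_cotSeries (by decide) (by decide) (by decide),
    tripleCotSum_eq_cotSeries (by decide) (by decide) (by decide), symSeries, Fin.sum_univ_four]
  simp only [herase, Matrix.cons_val]

theorem IsAdmissible.tendsto_tripleCotQuadruple {v : Fin 4 → ℝ}
    (hirr : Pairwise fun i j => Irrational (log (v i) / log (v j)))
    (hl : IsAdmissible (fun i => log (v i)) l) (hpos : ∀ i, 0 < log (v i)) (hx : 0 ≤ log x) :
    Tendsto (tripleCotQuadruple (v 0) (v 1) (v 2) (v 3) x) l
      (𝓝 (symLimit (fun i => log (v i)) (log x) Finset.univ)) :=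
  (hl.tendsto_symSeries hpos hirr hx _).congr fun _ => tripleCotQuadruple_eq_symSeries.symm

lemma pairSum_eq_symSeries [DecidableEq ι]
    (hirr : Pairwise fun i j => Irrational (log (v i) / log (v j))) (hij : i ≠ j) :
    pairSum (v i) (v j) x R =
      symSeries (fun i => log (v i)) (log x) {i} R + symSeries (fun i => log (v i)) (log x) {j} R -
        symSeries (fun i => log (v i)) (log x) {i, j} R := by
  have hi : ({i, j} : Finset ι).erase i = {j} := by grind
  have hj : ({i, j} : Finset ι).erase j = {i} := by grind
  have hsumi := sum_cos_div_sin_eq_cotSeries (ℓ := fun i => log (v i)) (y := log x) (R := R)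
    (hirr hij.symm)
  have hsumj := sum_cos_div_sin_eq_cotSeries (ℓ := fun i => log (v i)) (y := log x) (R := R)
    (hirr hij)
  rw [pairSum, hsumi, hsumj]
  simp only [symSeries, Finset.sum_singleton, Finset.erase_singleton, Finset.sum_pair hij, hi, hj]
  ring

lemma doubleSineTriple_eq_symSeries [DecidableEq ι]
    (hirr : Pairwise fun i j => Irrational (log (v i) / log (v j)))
    (hij : i ≠ j) (him : i ≠ m) (hjm : j ≠ m) :
    doubleSineTriple (v i) (v j) (v m) x R =
      2 * (symSeries (fun i => log (v i)) (log x) {i} R +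
          symSeries (fun i => log (v i)) (log x) {j} R +
          symSeries (fun i => log (v i)) (log x) {m} R) -
        2 * symSeries (fun i => log (v i)) (log x) {i, j, m} R := by
  have hi : ({i, j, m} : Finset ι).erase i = {j, m} := by grind
  have hj : ({i, j, m} : Finset ι).erase j = {i, m} := by grind
  have hm : ({i, j, m} : Finset ι).erase m = {i, j} := by grind
  rw [doubleSineTriple, doubleSineSum_eq_cotSeries hjm (hirr hij.symm) (hirr him.symm),
    doubleSineSum_eq_cotSeries him (hirr hij) (hirr hjm.symm),
    doubleSineSum_eq_cotSeries hij (hirr him) (hirr hjm)]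
  simp only [symSeries, Finset.sum_singleton, Finset.erase_singleton,
    Finset.sum_insert (show i ∉ ({j, m} : Finset ι) by simp [hij, him]), Finset.sum_pair hjm, hi,
    hj, hm]
  ring

theorem IsAdmissible.tendsto_pairSum [Finite ι] [DecidableEq ι]
    (hirr : Pairwise fun i j => Irrational (log (v i) / log (v j)))
    (hl : IsAdmissible (fun i => log (v i)) l) (hpos : ∀ i, 0 < log (v i)) (hx : 0 ≤ log x)
    (hij : i ≠ j) :
    Tendsto (pairSum (v i) (v j) x) l
      (𝓝 (symLimit (fun i => log (v i)) (log x) {i} + symLimit (fun i => log (v i)) (log x) {j} -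
        symLimit (fun i => log (v i)) (log x) {i, j})) :=
  have hlim := hl.tendsto_symSeries hpos hirr hx
  (((hlim _).add (hlim _)).sub (hlim _)).congr fun _ => (pairSum_eq_symSeries hirr hij).symm

theorem IsAdmissible.tendsto_doubleSineTriple [Finite ι] [DecidableEq ι]
    (hirr : Pairwise fun i j => Irrational (log (v i) / log (v j)))
    (hl : IsAdmissible (fun i => log (v i)) l) (hpos : ∀ i, 0 < log (v i)) (hx : 0 ≤ log x)
    (hij : i ≠ j) (him : i ≠ m) (hjm : j ≠ m) :
    Tendsto (doubleSineTriple (v i) (v j) (v m) x) l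
      (𝓝 (2 * (symLimit (fun i => log (v i)) (log x) {i} +
          symLimit (fun i => log (v i)) (log x) {j} +
          symLimit (fun i => log (v i)) (log x) {m}) -
        2 * symLimit (fun i => log (v i)) (log x) {i, j, m})) :=
  have hlim := hl.tendsto_symSeries hpos hirr hx
  (((((hlim _).add (hlim _)).add (hlim _)).const_mul 2).sub ((hlim _).const_mul 2)).congr fun _ =>
    (doubleSineTriple_eq_symSeries hirr hij him hjm).symm

end Series

section Quadruples

variable {a b c d : ℕ} {x δ : ℝ}

/-- The identification of functions on `Fin 4` with the nested quadruples that index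
`monomial`. -/
def quadrupleEquiv : (Fin 4 → ℕ) ≃ ℕ × ℕ × ℕ × ℕ where
  toFun e := (e 0, e 1, e 2, e 3)
  invFun q := ![q.1, q.2.1, q.2.2.1, q.2.2.2]
  left_inv e := by
    ext i
    fin_cases i <;> rfl
  right_inv _ := rfl

lemma prod_pow_eq_monomial (a b c d : ℕ) (e : Fin 4 → ℕ) :
    ∏ i, ![a, b, c, d] i ^ e i = monomial a b c d (quadrupleEquiv e) :=
  Fin.prod_univ_four _

lemma injective_prod_pow (h : Function.Injective (monomial a b c d)) :
    Function.Injective fun e : Fin 4 → ℕ => ∏ i, ![a, b, c, d] i ^ e i := by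
  simp only [prod_pow_eq_monomial]
  exact h.comp quadrupleEquiv.injective

lemma weightedCount_eq_N_sub_chi (h : Function.Injective (monomial a b c d)) (hx : 0 < x) :
    weightedCount (fun i => log (![a, b, c, d] i : ℕ)) Finset.univ (log x) =
      N a b c d x - chi a b c d x / 2 := by
  have hN : {e : Fin 4 → ℕ | ((monomial a b c d (quadrupleEquiv e) : ℕ) : ℝ) ≤ x}.ncard =
      N a b c d x :=
    ncard_preimage_of_injective_subset_range (s := {q | (monomial a b c d q : ℝ) ≤ x})
      quadrupleEquiv.injective (by simp only [quadrupleEquiv.range_eq_univ, subset_univ])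
  have hS : (range fun e => ((monomial a b c d (quadrupleEquiv e) : ℕ) : ℝ)) = S a b c d :=
    quadrupleEquiv.surjective.range_comp fun q => ((monomial a b c d q : ℕ) : ℝ)
  rw [weightedCount_log (injective_prod_pow h) hx]
  simp only [prod_pow_eq_monomial]
  rw [hN, hS]
  rfl

lemma cutoffFilter_eq (a b c d : ℕ) (δ : ℝ) :
    cutoffFilter a b c d δ =
      atTop ⊓ 𝓟 (cutoffs (fun i => log (![a, b, c, d] i : ℕ)) δ) := by
  have hset : goodCutoffs a b c d δ = cutoffs (fun i => log (![a, b, c, d] i : ℕ)) δ := by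
    ext R
    simp [goodCutoffs, cutoffs, Fin.forall_fin_succ]
  rw [cutoffFilter, hset]

lemma sum_powerset_univ_fin_four (f : Finset (Fin 4) → ℝ) :
    ∑ M ∈ Finset.univ.powerset, f M =
      f ∅ + (f {0} + f {1} + f {2} + f {3}) +
        (f {0, 1} + f {0, 2} + f {0, 3} + f {1, 2} + f {1, 3} + f {2, 3}) +
        (f {0, 1, 2} + f {0, 1, 3} + f {0, 2, 3} + f {1, 2, 3}) + f Finset.univ := by
  have hpowerset : (Finset.univ : Finset (Fin 4)).powerset = {∅, {0}, {1}, {2}, {3}, {0, 1},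
      {0, 2}, {0, 3}, {1, 2}, {1, 3}, {2, 3}, {0, 1, 2}, {0, 1, 3}, {0, 2, 3}, {1, 2, 3},
      Finset.univ} := by decide
  rw [hpowerset]
  repeat rw [Finset.sum_insert (by decide)]
  rw [Finset.sum_singleton]
  ring

lemma N_eq_mainPoly_add_sum_symLimit (h : Function.Injective (monomial a b c d)) (hx : 0 < x) :
    (N a b c d x : ℝ) = mainPoly a b c d x +
      1 / (8 * π) * ∑ M ∈ Finset.univ.powerset,
        symLimit (fun i => log (![a, b, c, d] i : ℕ)) (log x) M + chi a b c d x / 2 := by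
  have hmain := mainTerm_univ_eq_mainPoly (u := fun i => (![a, b, c, d] i : ℕ))
    (fun i => (log_pos_of_injective_prod_pow (injective_prod_pow h) i).ne') x
  rw [sum_powerset_symLimit Finset.univ_nonempty, weightedCount_eq_N_sub_chi h hx, hmain,
    Finset.card_fin]
  simp only [Matrix.cons_val]
  field_simp
  ring

end Quadruples

end SmoothCount

open SmoothCount in
theorem theorem9_general (a b c d : ℕ)
    (hunique : Function.Injective (monomial a b c d)) :
    (∃ δ₀ > 0, ∀ δ ≤ δ₀, (cutoffFilter a b c d δ).NeBot) ∧
    ∀ x : ℝ, 1 ≤ x →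
      ∃ Pab Pac Pad Pbc Pbd Pcd Tabc Tabd Tacd Tbcd Q : ℝ,
        (∀ δ > 0,
          Tendsto (pairSum a b x) (cutoffFilter a b c d δ) (𝓝 Pab) ∧
          Tendsto (pairSum a c x) (cutoffFilter a b c d δ) (𝓝 Pac) ∧
          Tendsto (pairSum a d x) (cutoffFilter a b c d δ) (𝓝 Pad) ∧
          Tendsto (pairSum b c x) (cutoffFilter a b c d δ) (𝓝 Pbc) ∧
          Tendsto (pairSum b d x) (cutoffFilter a b c d δ) (𝓝 Pbd) ∧
          Tendsto (pairSum c d x) (cutoffFilter a b c d δ) (𝓝 Pcd) ∧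
          Tendsto (doubleSineTriple a b c x)
            (cutoffFilter a b c d δ) (𝓝 Tabc) ∧
          Tendsto (doubleSineTriple a b d x)
            (cutoffFilter a b c d δ) (𝓝 Tabd) ∧
          Tendsto (doubleSineTriple a c d x)
            (cutoffFilter a b c d δ) (𝓝 Tacd) ∧
          Tendsto (doubleSineTriple b c d x)
            (cutoffFilter a b c d δ) (𝓝 Tbcd) ∧
          Tendsto (tripleCotQuadruple a b c d x)
            (cutoffFilter a b c d δ) (𝓝 Q)) ∧
        (N a b c d x : ℝ) =
          mainPoly a b c d x
            - 7 / 8 * B1star (log x / log a)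
            - 7 / 8 * B1star (log x / log b)
            - 7 / 8 * B1star (log x / log c)
            - 7 / 8 * B1star (log x / log d)
            - 1 / (8 * π) * (Pab + Pac + Pad + Pbc + Pbd + Pcd)
            - 1 / (16 * π) * (Tabc + Tabd + Tacd + Tbcd)
            + 1 / (8 * π) * Q
            + 1 / 2 * chi a b c d x := by
  have hinj := injective_prod_pow hunique
  have hpos := log_pos_of_injective_prod_pow hinj
  have hirr := irrational_log_div_log_of_injective_prod_pow hinj
  refine ⟨by simpa only [cutoffFilter_eq] using exists_cutoffs_neBot hpos, fun x hx => ?_⟩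
  have hy : 0 ≤ log x := log_nonneg hx
  have hl {δ : ℝ} (hδ : 0 < δ) : IsAdmissible (fun i => log (![a, b, c, d] i : ℕ))
      (cutoffFilter a b c d δ) := cutoffFilter_eq a b c d δ ▸ isAdmissible_cutoffs hpos hδ
  have hpair (i j : Fin 4) (hij : i ≠ j) {δ : ℝ} (hδ : 0 < δ) :=
    (hl hδ).tendsto_pairSum hirr hpos hy hij
  have htriple (i j m : Fin 4) (hij : i ≠ j) (him : i ≠ m) (hjm : j ≠ m) {δ : ℝ} (hδ : 0 < δ) :=
    (hl hδ).tendsto_doubleSineTriple hirr hpos hy hij him hjm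
  refine ⟨_, _, _, _, _, _, _, _, _, _, _, fun δ hδ => ⟨(hpair 0 1 (by decide) hδ :),
    (hpair 0 2 (by decide) hδ :), (hpair 0 3 (by decide) hδ :), (hpair 1 2 (by decide) hδ :),
    (hpair 1 3 (by decide) hδ :), (hpair 2 3 (by decide) hδ :),
    (htriple 0 1 2 (by decide) (by decide) (by decide) hδ :),
    (htriple 0 1 3 (by decide) (by decide) (by decide) hδ :),
    (htriple 0 2 3 (by decide) (by decide) (by decide) hδ :),
    (htriple 1 2 3 (by decide) (by decide) (by decide) hδ :),
    ((hl hδ).tendsto_tripleCotQuadruple hirr hpos hy :)⟩, ?_⟩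
  rw [N_eq_mainPoly_add_sum_symLimit hunique (zero_lt_one.trans_le hx), sum_powerset_univ_fin_four,
    symLimit_empty]
  have hsingleton (i : Fin 4) := symLimit_singleton (ℓ := fun i => log (![a, b, c, d] i : ℕ))
    (hpos i) hy
  simp only [hsingleton, Matrix.cons_val]
  field_simp
  ring

theorem theorem9 (a b c d : ℕ) (hab : a < b) (hbc : b < c) (hcd : c < d)
    (hgcd : Nat.gcd a (Nat.gcd b (Nat.gcd c d)) = 1)
    (hunique : Function.Injective (SmoothCount.monomial a b c d)) :
    -- for small distances, the limits below run through arbitrarily large cut-offs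
    (∃ δ₀ > 0, ∀ δ ≤ δ₀, (SmoothCount.cutoffFilter a b c d δ).NeBot) ∧
    ∀ x : ℝ, 1 ≤ x →
      ∃ Pab Pac Pad Pbc Pbd Pcd Tabc Tabd Tacd Tbcd Q : ℝ,
        -- the values of the series
        (∀ δ > 0,
          Tendsto (SmoothCount.pairSum a b x) (SmoothCount.cutoffFilter a b c d δ) (𝓝 Pab) ∧
          Tendsto (SmoothCount.pairSum a c x) (SmoothCount.cutoffFilter a b c d δ) (𝓝 Pac) ∧
          Tendsto (SmoothCount.pairSum a d x) (SmoothCount.cutoffFilter a b c d δ) (𝓝 Pad) ∧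
          Tendsto (SmoothCount.pairSum b c x) (SmoothCount.cutoffFilter a b c d δ) (𝓝 Pbc) ∧
          Tendsto (SmoothCount.pairSum b d x) (SmoothCount.cutoffFilter a b c d δ) (𝓝 Pbd) ∧
          Tendsto (SmoothCount.pairSum c d x) (SmoothCount.cutoffFilter a b c d δ) (𝓝 Pcd) ∧
          Tendsto (SmoothCount.doubleSineTriple a b c x)
            (SmoothCount.cutoffFilter a b c d δ) (𝓝 Tabc) ∧
          Tendsto (SmoothCount.doubleSineTriple a b d x)
            (SmoothCount.cutoffFilter a b c d δ) (𝓝 Tabd) ∧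
          Tendsto (SmoothCount.doubleSineTriple a c d x)
            (SmoothCount.cutoffFilter a b c d δ) (𝓝 Tacd) ∧
          Tendsto (SmoothCount.doubleSineTriple b c d x)
            (SmoothCount.cutoffFilter a b c d δ) (𝓝 Tbcd) ∧
          Tendsto (SmoothCount.tripleCotQuadruple a b c d x)
            (SmoothCount.cutoffFilter a b c d δ) (𝓝 Q)) ∧
        (SmoothCount.N a b c d x : ℝ) =
          SmoothCount.mainPoly a b c d x
            - 7 / 8 * SmoothCount.B1star (log x / log a)
            - 7 / 8 * SmoothCount.B1star (log x / log b)
            - 7 / 8 * SmoothCount.B1star (log x / log c)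
            - 7 / 8 * SmoothCount.B1star (log x / log d)
            - 1 / (8 * π) * (Pab + Pac + Pad + Pbc + Pbd + Pcd)
            - 1 / (16 * π) * (Tabc + Tabd + Tacd + Tbcd)
            + 1 / (8 * π) * Q
            + 1 / 2 * SmoothCount.chi a b c d x :=
  theorem9_general a b c d hunique
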